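/- **Theorem 2.1.** Let $k\ge 2$ be an integer and $p\in(0,1)$ with $kp>1$. Divide $[0,1]^2$ into its $k^2$ closed subsquares of side $1/k$, and keep each of them with probability $p$; divide every kept square again into $k^2$ closed subsquares of side $k^{-2}$ and keep each of these with probability $p$; and so on, all choices being independent. Let $\mathcal E_n$ be the set of squares of side $k^{-n}$ kept after $n$ steps, $E_n$ their union, and $E=\bigcap_n E_n$ the percolation fractal. For $\theta\in[0,\pi)$ put $\pi_\theta(x,y)=x\cos\theta+y\sin\theta$. A point of $\mathbb R$ is called $k$-adic if it has the form $mk^{-\ell}$ with $m\in\mathbb Z$ and an integer $\ell\ge 0$, and the $k$-symbolic metric is $$\rho(x,y)=\exp\bigl(-\log k\cdot\min\{\ell\ge 0:\ \exists m\in\mathbb Z,\ x<mk^{-\ell}<y\}\bigr)\quad (x<y),\qquad \rho(y,x)=\rho(x,y),\quad \rho(x,x)=0 .$$ There is an exponent $\alpha>0$ such that almost surely, if $E$ is nonempty, the following holds. The limit $Z=\lim_{n\to\infty}(k^2p)^{-n}\,\#\mathcal E_n$ exists and is positive and finite, the natural measure $$\mu=\lim_{n\to\infty}\frac{1}{p^nZ}\,\mathrm{Leb}|_{E_n}$$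 exists as a weak limit and is a probability measure, and its projections $\mu^\theta$ (the images of $\mu$ under $\pi_\theta$) satisfy: 1. for every $\theta\in[0,\pi)$, $\mu^\theta$ is absolutely continuous with respect to Lebesgue measure; 2. for every $\theta\in[0,\pi)\setminus\{0,\pi/2\}$, $\mu^\theta$ has a density on $\mathbb R$ that is Hölder continuous with exponent $\alpha$ (with a constant that may depend on $\theta$ and on the realization); 3. for $\theta\in\{0,\pi/2\}$, $\mu^\theta$ has a density $g$ that is Hölder continuous in the metric $\rho$ away from the $k$-adic points: there is a constant $C$ (which may depend on the realization) with $|g(x)-g(y)|\le C\rho(x,y)^{\alpha}$ for all $x,y\in\mathbb R$ that are not $k$-adic. -/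

import Mathlib

open MeasureTheory ProbabilityTheory Filter Topology
open scoped NNReal ENNReal BoundedContinuousFunction

namespace FractalPercolation

/-- The set `Σ_n` of pairs of words of length `n` over the alphabet `{0, …, k-1}`;
they are the addresses of the `k`-adic squares of level `n`. -/
abbrev Address (k n : ℕ) : Type := (Fin n → Fin k) × (Fin n → Fin k)

/-- The address of the square of level `n` that contains a given square of level `n + 1`:
the last letter of both words is removed. -/
def parent {k n : ℕ} (c : Address k (n + 1)) : Address k n :=
  (Fin.init c.1, Fin.init c.2)

/-- The left end point `∑ ℓ, i_ℓ k^{-ℓ}` of the `k`-adic interval with address `i`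
(the letters are numbered from `0` here, hence the exponent `ℓ + 1`). -/
noncomputable def leftEnd {k n : ℕ} (i : Fin n → Fin k) : ℝ :=
  ∑ l : Fin n, ((i l : ℕ) : ℝ) / (k : ℝ) ^ ((l : ℕ) + 1)

/-- The closed `k`-adic interval of length `k^{-n}` with address `i`. -/
noncomputable def interval {k n : ℕ} (i : Fin n → Fin k) : Set ℝ :=
  Set.Icc (leftEnd i) (leftEnd i + 1 / (k : ℝ) ^ n)

/-- The closed `k`-adic square of side `k^{-n}` with address `c`. -/
noncomputable def square {k n : ℕ} (c : Address k n) : Set (ℝ × ℝ) :=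
  interval c.1 ×ˢ interval c.2

/-- A configuration of the percolation: it says for each `k`-adic square whether the square is
kept when its parent is. (The entry of level `0` is never used: the unit square is kept.) -/
abbrev Config (k : ℕ) : Type := (Σ n : ℕ, Address k n) → Bool

/-- A square is retained if its parent is retained and the square itself is kept. -/
def Retained {k : ℕ} (x : Config k) : (n : ℕ) → Address k n → Prop
  | 0, _ => True
  | n + 1, c => Retained x n (parent c) ∧ x ⟨n + 1, c⟩ = true

open scoped Classical in
/-- The set `𝓔_n` of addresses of the retained squares of level `n`. -/
noncomputable def retainedSet {k : ℕ} (x : Config k) (n : ℕ) : Finset (Address k n) :=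
  Finset.univ.filter fun c => Retained x n c

/-- The set `E_n`, the union of the retained squares of level `n`. -/
noncomputable def levelSet {k : ℕ} (x : Config k) (n : ℕ) : Set (ℝ × ℝ) :=
  ⋃ c ∈ retainedSet x n, square c

/-- The percolation fractal `E = ⋂ n, E_n`. -/
noncomputable def fractal {k : ℕ} (x : Config k) : Set (ℝ × ℝ) :=
  ⋂ n : ℕ, levelSet x n

/-- The measure `(p^n Z)⁻¹ Leb|_{E_n}`. -/
noncomputable def levelMeasure {k : ℕ} (p Z : ℝ) (x : Config k) (n : ℕ) : Measure (ℝ × ℝ) :=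
  ENNReal.ofReal (1 / (p ^ n * Z)) • (volume : Measure (ℝ × ℝ)).restrict (levelSet x n)

/-- `μ` is the natural measure of the realization `x`: the limit
`Z = lim (k² p)^{-n} #𝓔_n` exists and is a positive (finite) number, and the probability measure
`μ` is the weak limit of the measures `(p^n Z)⁻¹ Leb|_{E_n}`. There is at most one such `μ`. -/
def IsNaturalMeasure {k : ℕ} (p : ℝ) (x : Config k) (μ : Measure (ℝ × ℝ)) : Prop :=
  ∃ Z : ℝ, 0 < Z ∧
    Tendsto (fun n : ℕ => ((retainedSet x n).card : ℝ) / ((k : ℝ) ^ 2 * p) ^ n) atTop (𝓝 Z) ∧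
    IsProbabilityMeasure μ ∧
    ∀ f : (ℝ × ℝ) →ᵇ ℝ,
      Tendsto (fun n : ℕ => ∫ z, f z ∂(levelMeasure p Z x n)) atTop (𝓝 (∫ z, f z ∂μ))

/-- The orthogonal projection `π_θ (x, y) = x cos θ + y sin θ`. -/
noncomputable def proj (θ : ℝ) (z : ℝ × ℝ) : ℝ :=
  z.1 * Real.cos θ + z.2 * Real.sin θ

/-- The function `g` is a version of the density of the measure `ν` on the line. -/
def IsDensity (ν : Measure ℝ) (g : ℝ → ℝ≥0) : Prop :=
  Measurable g ∧ ν = (volume : Measure ℝ).withDensity fun t => (g t : ℝ≥0∞)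

/-- The `k`-adic points of the line. -/
def kadicPoints (k : ℕ) : Set ℝ :=
  {t | ∃ (m : ℤ) (l : ℕ), t = (m : ℝ) / (k : ℝ) ^ l}

/-- The `k`-symbolic metric
`ρ(s, t) = exp (- log k · min {ℓ : ∃ m, s < m k^{-ℓ} < t})` for `s < t`, extended to all pairs
by symmetry and by `ρ(t, t) = 0`. -/
noncomputable def symbolicDist (k : ℕ) (s t : ℝ) : ℝ :=
  if s = t then 0
  else Real.exp (-(Real.log k *
    ((sInf {l : ℕ | ∃ m : ℤ, min s t < (m : ℝ) / (k : ℝ) ^ l ∧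
      (m : ℝ) / (k : ℝ) ^ l < max s t} : ℕ) : ℝ)))

end FractalPercolation

/-! Fix a unit vector (a, b) with ab ≠ 0 and let f_n be the density of the image of p⁻ⁿ Leb|_{E_n}
under (x, y) ↦ ax + by. It is a sum of explicit trapezoidal kernels, one per retained square, and
the kernel of a square is the sum of the kernels of its k² children. So, given level n, f_{n+1}(t)
is a sum of independent terms with mean f_n(t). Each term is O((kp)⁻ⁿ), and Hoeffding's inequality
shows that |f_{n+1}(t) - f_n(t)| exceeds γⁿ(1 + f_n(t)) with probability at most 2 exp(-c(kpγ²)ⁿ).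
Since kp > 1, some γ < 1 has kpγ² > 1, and this bound beats every exponential
(`IsPercolation.measure_retainedSum_sub_le`).

A union bound over a grid of exponentially many lines, Borel–Cantelli and a deterministic Lipschitz
bound of order (k²/p)ⁿ give the estimate for all lines at once, outside one null set
(`IsPercolation.ae_eventually_projSum`). To stay uniform near the axes, the sums there are not
divided by |ab|; the division comes last and makes the constants depend on θ. Increments of size
Cγⁿ(1 + f_n) force uniform geometric convergence (`exists_geometric_limit`), and balancing the error
γⁿ against the Lipschitz growth (k²/p)ⁿ makes the limit Hölder. In the axis directions the kernels
are indicators of columns or rows: no approximation is needed, but f_n is only constant on k-adic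
intervals, whence the symbolic metric.

The existence of Z comes for free as the integral of the limit density. Its positivity needs
survival: generating functions, compared with iterable linear fractional maps, bound by 2/3 the
conditional probability of a vanishing limit given a nonempty generation, and Lévy's upward theorem
concludes (`IsPercolation.ae_notMem_vanishing`).

Every frequency (u, v) lies on a line through the origin, where the characteristic function of p⁻ⁿ
Leb|_{E_n} converges to the Fourier transform of the limit density for that direction. Lévy's
continuity theorem then yields μ, and uniqueness of characteristic functions identifies the
densities of its projections. -/

namespace FractalPercolation

/-! ### Combinatorics and geometry of k-adic squares. -/

section Addresses

variable {k n : ℕ}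

/-- The address of a child of the square with address `d`. -/
def child (d : Address k n) (i j : Fin k) : Address k (n + 1) :=
  (Fin.snoc d.1 i, Fin.snoc d.2 j)

@[simp] lemma parent_child (d : Address k n) (i j : Fin k) : parent (child d i j) = d := by
  simp [parent, child]

/-- An address of level `n + 1` is an address of level `n` followed by two letters. -/
def childEquiv (k n : ℕ) : Address k n × Fin k × Fin k ≃ Address k (n + 1) where
  toFun q := child q.1 q.2.1 q.2.2
  invFun c := (parent c, c.1 (Fin.last n), c.2 (Fin.last n))
  left_inv q := by simp [parent, child]
  right_inv c := by simp [parent, child]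

/-- The addresses of the children of a set of squares. -/
def children (S : Finset (Address k n)) : Finset (Address k (n + 1)) :=
  Finset.univ.filter fun c => parent c ∈ S

@[simp] lemma mem_children {S : Finset (Address k n)} {c : Address k (n + 1)} :
    c ∈ children S ↔ parent c ∈ S := by
  simp [children]

lemma sum_children {M : Type*} [AddCommMonoid M] (S : Finset (Address k n))
    (F : Address k (n + 1) → M) :
    ∑ c ∈ children S, F c = ∑ d ∈ S, ∑ i, ∑ j, F (child d i j) := by
  classical
  rw [children, Finset.sum_filter, ← (childEquiv k n).sum_comp, Fintype.sum_prod_type]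
  trans ∑ d : Address k n, if d ∈ S then ∑ i, ∑ j, F (child d i j) else 0
  · refine Finset.sum_congr rfl fun d _ => ?_
    rw [Fintype.sum_prod_type]
    simp only [childEquiv, Equiv.coe_fn_mk, parent_child]
    split_ifs <;> simp
  · simp

lemma card_children (S : Finset (Address k n)) : (children S).card = k ^ 2 * S.card := by
  rw [Finset.card_eq_sum_ones, sum_children]
  simp [sq, mul_comm]

@[simp] lemma mem_retainedSet {x : Config k} {c : Address k n} :
    c ∈ retainedSet x n ↔ Retained x n c := by
  simp [retainedSet]

lemma mem_retainedSet_succ {x : Config k} {c : Address k (n + 1)} :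
    c ∈ retainedSet x (n + 1) ↔ c ∈ children (retainedSet x n) ∧ x ⟨n + 1, c⟩ = true := by
  simp [Retained]

lemma retainedSet_succ (x : Config k) (n : ℕ) :
    retainedSet x (n + 1) =
      (children (retainedSet x n)).filter fun c => x ⟨n + 1, c⟩ = true := by
  ext c
  rw [mem_retainedSet_succ, Finset.mem_filter]

lemma card_retainedSet_le (x : Config k) (n : ℕ) : (retainedSet x n).card ≤ (k ^ 2) ^ n := by
  induction n with
  | zero => exact (Finset.card_le_univ _).trans (by simp)
  | succ n ih =>
    rw [retainedSet_succ]
    refine (Finset.card_filter_le _ _).trans ?_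
    rw [card_children, pow_succ' (k ^ 2)]
    exact Nat.mul_le_mul_left _ ih

lemma leftEnd_succ (i : Fin (n + 1) → Fin k) :
    leftEnd i = leftEnd (Fin.init i) + ((i (Fin.last n) : ℕ) : ℝ) / (k : ℝ) ^ (n + 1) := by
  simp [leftEnd, Fin.sum_univ_castSucc, Fin.init]

lemma leftEnd_snoc (d : Fin n → Fin k) (i : Fin k) :
    leftEnd (Fin.snoc d i : Fin (n + 1) → Fin k) = leftEnd d + ((i : ℕ) : ℝ) / (k : ℝ) ^ (n + 1) := by
  rw [leftEnd_succ]; simp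

lemma leftEnd_nonneg (i : Fin n → Fin k) : 0 ≤ leftEnd i :=
  Finset.sum_nonneg fun _ _ => by positivity

lemma last_add_le (hk : 2 ≤ k) (n : ℕ) (i : Fin k) :
    ((i : ℕ) : ℝ) / (k : ℝ) ^ (n + 1) + 1 / (k : ℝ) ^ (n + 1) ≤ 1 / (k : ℝ) ^ n := by
  have hk0 : (0 : ℝ) < k := by positivity
  have : ((i : ℕ) : ℝ) + 1 ≤ k := by exact_mod_cast i.2
  rw [← add_div, pow_succ', div_le_div_iff₀ (by positivity) (by positivity)]
  nlinarith [pow_pos hk0 n]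

lemma leftEnd_add_le_one (hk : 2 ≤ k) (i : Fin n → Fin k) :
    leftEnd i + 1 / (k : ℝ) ^ n ≤ 1 := by
  induction n with
  | zero => simp [leftEnd]
  | succ n ih =>
    rw [leftEnd_succ]
    linarith [ih (Fin.init i), last_add_le hk n (i (Fin.last n))]

lemma leftEnd_le_one (hk : 2 ≤ k) (i : Fin n → Fin k) : leftEnd i ≤ 1 :=
  le_trans (by simp only [le_add_iff_nonneg_right]; positivity) (leftEnd_add_le_one hk i)

lemma interval_subset_init (hk : 2 ≤ k) (i : Fin (n + 1) → Fin k) :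
    interval i ⊆ interval (Fin.init i) := by
  refine Set.Icc_subset_Icc ?_ ?_
  · rw [leftEnd_succ]; simp only [le_add_iff_nonneg_right]; positivity
  · rw [leftEnd_succ]; linarith [last_add_le hk n (i (Fin.last n))]

lemma interval_subset_unit (hk : 2 ≤ k) (i : Fin n → Fin k) : interval i ⊆ Set.Icc 0 1 :=
  Set.Icc_subset_Icc (leftEnd_nonneg i) (leftEnd_add_le_one hk i)

/-- Siblings share at most an end point; for other pairs the parents already overlap in a null set,
so induct on the level. -/
lemma volume_interval_inter (hk : 2 ≤ k) {i j : Fin n → Fin k} (h : i ≠ j) :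
    volume (interval i ∩ interval j) = 0 := by
  induction n with
  | zero => exact absurd (Subsingleton.elim i j) h
  | succ n ih =>
    by_cases hij : Fin.init i = Fin.init j
    · have hl : i (Fin.last n) ≠ j (Fin.last n) := fun hl => h <| by
        rw [← Fin.snoc_init_self i, ← Fin.snoc_init_self j, hij, hl]
      wlog hlt : i (Fin.last n) < j (Fin.last n) generalizing i j
      · rw [Set.inter_comm]
        exact this h.symm hij.symm hl.symm (lt_of_le_of_ne (not_lt.1 hlt) hl.symm)
      have h1 : leftEnd i + 1 / (k : ℝ) ^ (n + 1) ≤ leftEnd j := by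
        rw [leftEnd_succ, leftEnd_succ, hij, add_assoc, ← add_div]
        have : ((i (Fin.last n) : ℕ) : ℝ) + 1 ≤ ((j (Fin.last n) : ℕ) : ℝ) := by
          exact_mod_cast hlt
        gcongr
      refine measure_mono_null (t := {leftEnd j}) ?_ (by simp)
      rintro x ⟨h2, h3⟩
      exact le_antisymm (h2.2.trans h1) h3.1
    · exact measure_mono_null (Set.inter_subset_inter (interval_subset_init hk i)
        (interval_subset_init hk j)) (ih hij)

lemma volume_square (c : Address k n) :
    volume (square c) = ENNReal.ofReal (1 / ((k : ℝ) ^ 2) ^ n) := by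
  rw [square, Measure.volume_eq_prod, Measure.prod_prod, interval, interval, Real.volume_Icc,
    Real.volume_Icc, add_sub_cancel_left, add_sub_cancel_left,
    ← ENNReal.ofReal_mul (by positivity)]
  congr 1
  rw [div_mul_div_comm, one_mul, ← mul_pow, sq]

lemma measurableSet_square (c : Address k n) : MeasurableSet (square c) :=
  measurableSet_Icc.prod measurableSet_Icc

lemma volume_square_inter (hk : 2 ≤ k) {c d : Address k n} (h : c ≠ d) :
    volume (square c ∩ square d) = 0 := by
  rw [square, square, Set.prod_inter_prod, Measure.volume_eq_prod, Measure.prod_prod]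
  by_cases h1 : c.1 = d.1
  · rw [volume_interval_inter hk (fun h2 => h (Prod.ext h1 h2)), mul_zero]
  · rw [volume_interval_inter hk h1, zero_mul]

lemma square_subset_unit (hk : 2 ≤ k) (c : Address k n) :
    square c ⊆ Set.Icc 0 1 ×ˢ Set.Icc 0 1 :=
  Set.prod_mono (interval_subset_unit hk c.1) (interval_subset_unit hk c.2)

lemma measurableSet_levelSet (x : Config k) (n : ℕ) : MeasurableSet (levelSet x n) :=
  Finset.measurableSet_biUnion _ fun c _ => measurableSet_square c

lemma levelSet_subset_unit (hk : 2 ≤ k) (x : Config k) (n : ℕ) :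
    levelSet x n ⊆ Set.Icc 0 1 ×ˢ Set.Icc 0 1 :=
  Set.iUnion₂_subset fun c _ => square_subset_unit hk c

end Addresses

/-- The family `X` of random bits is independent, and each bit is `true` with probability `p`. -/
structure IsPercolation {Ω : Type*} [MeasurableSpace Ω] (P : Measure Ω) {k : ℕ} (p : ℝ)
    (X : (Σ n : ℕ, Address k n) → Ω → Bool) : Prop where
  measurable : ∀ c, Measurable (X c)
  indep : iIndepFun X P
  law : ∀ c, P {ω | X c ω = true} = ENNReal.ofReal p

lemma measurable_indicator_one {Ω : Type*} {m : MeasurableSpace Ω} {s : Set Ω}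
    (hs : MeasurableSet s) : Measurable (s.indicator (1 : Ω → ℝ≥0∞)) :=
  measurable_one.indicator hs

/-! ### The filtration by levels and independence of the next level. -/

section Filtration

variable {Ω : Type*} [mΩ : MeasurableSpace Ω] {P : Measure Ω} {k : ℕ} {p : ℝ}
  {X : (Σ n : ℕ, Address k n) → Ω → Bool}

/-- The configuration at `ω`. -/
abbrev config (X : (Σ n : ℕ, Address k n) → Ω → Bool) (ω : Ω) : Config k := fun c => X c ω

/-- The `σ`-algebra generated by the bits whose indices lie in `s`. -/
@[reducible] def sigmaOf (X : (Σ n : ℕ, Address k n) → Ω → Bool) (s : Set (Σ n : ℕ, Address k n)) :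
    MeasurableSpace Ω :=
  ⨆ c ∈ s, MeasurableSpace.comap (X c) inferInstance

lemma sigmaOf_le (hX : ∀ c, Measurable (X c)) (s : Set (Σ n : ℕ, Address k n)) :
    sigmaOf X s ≤ mΩ :=
  iSup₂_le fun c _ => (hX c).comap_le

omit mΩ in
lemma measurable_sigmaOf {s : Set (Σ n : ℕ, Address k n)} {c : Σ n : ℕ, Address k n}
    (hc : c ∈ s) : Measurable[sigmaOf X s] (X c) :=
  Measurable.of_comap_le (le_iSup₂_of_le c hc le_rfl)

/-- The `σ`-algebras generated by the bits up to level `n`. -/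
def levelFiltration (hX : ∀ c, Measurable (X c)) : Filtration ℕ mΩ where
  seq n := sigmaOf X {c | c.1 ≤ n}
  mono' _ _ h := biSup_mono fun _ hc => le_trans hc h
  le' _ := sigmaOf_le hX _

/-- The `σ`-algebra generated by the bits of level `n + 1`. -/
abbrev nextLevel (X : (Σ n : ℕ, Address k n) → Ω → Bool) (n : ℕ) : MeasurableSpace Ω :=
  sigmaOf X {c | c.1 = n + 1}

lemma measurableSet_retained (hX : ∀ c, Measurable (X c)) (n : ℕ) (c : Address k n) :
    MeasurableSet[levelFiltration hX n] {ω | Retained (config X ω) n c} := by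
  induction n with
  | zero => simp [Retained]
  | succ n ih =>
    have h1 := (levelFiltration hX).mono n.le_succ _ (ih (parent c))
    have h2 : MeasurableSet[levelFiltration hX (n + 1)] {ω | X ⟨n + 1, c⟩ ω = true} :=
      measurable_sigmaOf (X := X) (s := {c | c.1 ≤ n + 1}) (c := ⟨n + 1, c⟩) (by simp)
        (measurableSet_singleton true)
    exact MeasurableSet.inter h1 h2

lemma measurable_retainedSet (hX : ∀ c, Measurable (X c)) (n : ℕ) :
    Measurable[levelFiltration hX n, ⊤] fun ω => retainedSet (config X ω) n := by
  let _ : MeasurableSpace (Finset (Address k n)) := ⊤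
  have : MeasurableSingletonClass (Finset (Address k n)) := ⟨fun _ => trivial⟩
  refine @measurable_to_countable' _ _ _ _ (levelFiltration hX n) _ fun S => ?_
  have : (fun ω => retainedSet (config X ω) n) ⁻¹' {S}
      = ⋂ c, {ω | Retained (config X ω) n c ↔ c ∈ S} := by
    ext ω
    simp [Finset.ext_iff]
  rw [this]
  refine MeasurableSet.iInter fun c => ?_
  by_cases hc : c ∈ S
  · simpa [hc] using! measurableSet_retained hX n c
  · have h := (measurableSet_retained hX n c).compl
    simp only [hc, iff_false]
    exact h

lemma measurableSet_retainedSet_eq (hX : ∀ c, Measurable (X c)) (n : ℕ)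
    (S : Finset (Address k n)) :
    MeasurableSet[levelFiltration hX n] {ω | retainedSet (config X ω) n = S} :=
  @measurable_retainedSet _ _ _ _ hX n {S} trivial

lemma measurable_comp_retainedSet {β : Type*} [MeasurableSpace β] (hX : ∀ c, Measurable (X c))
    (n : ℕ) (f : Finset (Address k n) → β) :
    Measurable[levelFiltration hX n] fun ω => f (retainedSet (config X ω) n) :=
  @Measurable.comp _ _ _ (levelFiltration hX n) ⊤ _ f _ measurable_from_top
    (measurable_retainedSet hX n)

lemma IsPercolation.indep_nextLevel (h : IsPercolation P p X) (n : ℕ) :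
    Indep (levelFiltration h.measurable n) (nextLevel X n) P := by
  refine indep_iSup_of_disjoint (fun c => (h.measurable c).comap_le) h.indep ?_
  rw [Set.disjoint_left]
  intro c hc hc'
  simp only [Set.mem_ofPred_eq] at hc hc'
  omega

/-- The retained set takes finitely many values and depends on the bits up to level `n` only.
Splitting according to its value `S` allows the bits of level `n + 1` to be averaged with `S`
frozen; this plays the role of conditioning on level `n`. -/
lemma IsPercolation.setLIntegral_retainedSet (h : IsPercolation P p X) (n : ℕ) {T : Set Ω}
    (hT : MeasurableSet[levelFiltration h.measurable n] T)
    {Y : Finset (Address k n) → Ω → ℝ≥0∞} (hY : ∀ S, Measurable[nextLevel X n] (Y S)) :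
    ∫⁻ ω in T, Y (retainedSet (config X ω) n) ω ∂P
      = ∫⁻ ω in T, ∫⁻ ω', Y (retainedSet (config X ω) n) ω' ∂P ∂P := by
  classical
  have hF := (levelFiltration h.measurable).le n
  have hG : nextLevel X n ≤ mΩ := sigmaOf_le h.measurable _
  set E : Finset (Address k n) → Set Ω := fun S => {ω | retainedSet (config X ω) n = S} with hE
  have hEm : ∀ S, MeasurableSet[levelFiltration h.measurable n] (E S) :=
    measurableSet_retainedSet_eq h.measurable n
  have key : ∀ W : Finset (Address k n) → Ω → ℝ≥0∞, (∀ S, Measurable (W S)) →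
      ∫⁻ ω in T, W (retainedSet (config X ω) n) ω ∂P
        = ∑ S, ∫⁻ ω, (T ∩ E S).indicator 1 ω * W S ω ∂P := by
    intro W hW
    rw [← lintegral_indicator (hF _ hT), ← lintegral_finsetSum]
    · refine lintegral_congr fun ω => ?_
      rw [Finset.sum_eq_single (retainedSet (config X ω) n)]
      · by_cases hω : ω ∈ T <;> simp [hω, hE, Set.indicator]
      · intro S _ hS
        simp [hE, Set.indicator, hS.symm]
      · simp
    · intro S _
      exact (measurable_one.indicator ((hF _ hT).inter (hF _ (hEm S)))).mul (hW S)
  rw [key Y fun S => (hY S).mono hG le_rfl,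
    key (fun S _ => ∫⁻ ω', Y S ω' ∂P) fun S => measurable_const]
  refine Finset.sum_congr rfl fun S _ => ?_
  rw [lintegral_mul_eq_lintegral_mul_lintegral_of_independent_measurableSpace hF hG
    (h.indep_nextLevel n)
    (measurable_indicator_one (hT.inter (hEm S))) (hY S), lintegral_mul_const]
  exact measurable_indicator_one ((hF _ hT).inter (hF _ (hEm S)))

/-- A tail bound that is uniform over deterministic sets `S` remains valid when the random retained
set is substituted for `S`. -/
lemma IsPercolation.measure_retainedSet_le (h : IsPercolation P p X) (n : ℕ)
    {B : Finset (Address k n) → Set Ω} (hB : ∀ S, MeasurableSet[nextLevel X n] (B S))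
    {δ : ℝ≥0∞} (hδ : ∀ S, P (B S) ≤ δ) [IsProbabilityMeasure P] :
    P {ω | ω ∈ B (retainedSet (config X ω) n)} ≤ δ := by
  have hG : nextLevel X n ≤ mΩ := sigmaOf_le h.measurable _
  have h1 := h.setLIntegral_retainedSet n (T := Set.univ) MeasurableSet.univ
    (Y := fun S => (B S).indicator 1)
    fun S => measurable_indicator_one (hB S)
  simp only [Measure.restrict_univ] at h1
  have hm : MeasurableSet {ω | ω ∈ B (retainedSet (config X ω) n)} := by
    have : {ω | ω ∈ B (retainedSet (config X ω) n)}
        = ⋃ S, {ω | retainedSet (config X ω) n = S} ∩ B S := by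
      ext ω; simp
    rw [this]
    exact MeasurableSet.iUnion fun S => ((levelFiltration h.measurable).le n _
      (measurableSet_retainedSet_eq h.measurable n S)).inter (hG _ (hB S))
  rw [← lintegral_indicator_one hm]
  refine (lintegral_congr fun ω => ?_).trans_le (h1.le.trans ?_)
  · by_cases hω : ω ∈ B (retainedSet (config X ω) n) <;> simp [hω]
  · calc _ ≤ ∫⁻ _, δ ∂P := by
          refine lintegral_mono fun ω => ?_
          dsimp only
          rw [lintegral_indicator_one (hG _ (hB _))]
          exact hδ _
      _ = δ := by simp

end Filtration

lemma measurableSet_lt_abs_sub {Ω : Type*} {m : MeasurableSpace Ω} {f : Ω → ℝ}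
    (hf : Measurable f) (a b : ℝ) : MeasurableSet {ω | a < |f ω - b|} :=
  measurableSet_lt measurable_const (hf.sub measurable_const).abs

/-! ### Hoeffding bounds, union bound and Borel–Cantelli. -/

section Deviation

variable {Ω : Type*} [mΩ : MeasurableSpace Ω] {P : Measure Ω} [IsProbabilityMeasure P]
  {k n : ℕ} {p : ℝ} {X : (Σ n : ℕ, Address k n) → Ω → Bool}

/-- The sum of the weights of the kept squares among those in `s`. -/
noncomputable def keptSum (X : (Σ n : ℕ, Address k n) → Ω → Bool)
    (s : Finset (Address k (n + 1))) (w : Address k (n + 1) → ℝ) (ω : Ω) : ℝ :=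
  ∑ c ∈ s, if X ⟨n + 1, c⟩ ω = true then w c else 0

omit mΩ in
lemma sum_retainedSet_succ (w : Address k (n + 1) → ℝ) (ω : Ω) :
    ∑ c ∈ retainedSet (config X ω) (n + 1), w c
      = keptSum X (children (retainedSet (config X ω) n)) w ω := by
  rw [retainedSet_succ, Finset.sum_filter, keptSum]

omit mΩ in
lemma measurable_keptSum (s : Finset (Address k (n + 1))) (w : Address k (n + 1) → ℝ) :
    Measurable[nextLevel X n] (keptSum X s w) := by
  refine Finset.measurable_fun_sum _ fun c _ => ?_
  have h : Measurable[nextLevel X n] (X ⟨n + 1, c⟩) :=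
    measurable_sigmaOf (X := X) (s := {c | c.1 = n + 1}) (c := ⟨n + 1, c⟩) rfl
  exact (measurable_from_top (f := fun b : Bool => if b = true then w c else 0)).comp h

lemma IsPercolation.integral_ite (h : IsPercolation P p X) (hp : 0 ≤ p) (c : Σ n, Address k n)
    (u v : ℝ) : ∫ ω, (if X c ω = true then u else v) ∂P = p * u + (1 - p) * v := by
  have hm : MeasurableSet {ω | X c ω = true} := h.measurable c (measurableSet_singleton true)
  have hr : P.real {ω | X c ω = true} = p := by
    rw [measureReal_def, h.law, ENNReal.toReal_ofReal hp]
  have : (fun ω => if X c ω = true then u else v)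
      = fun ω => {ω | X c ω = true}.indicator (fun _ => u - v) ω + v := by
    ext ω
    by_cases hω : X c ω = true <;> simp [hω]
  rw [this, integral_add ((integrable_const _).indicator hm) (integrable_const _),
    integral_indicator_const _ hm, hr]
  simp
  ring

omit [IsProbabilityMeasure P] in
lemma IsPercolation.iIndepFun_level (h : IsPercolation P p X) (n : ℕ) :
    iIndepFun (fun c : Address k n => X ⟨n, c⟩) P :=
  h.indep.precomp (g := fun c : Address k n => (⟨n, c⟩ : Σ n, Address k n))
    fun _ _ h => eq_of_heq (Sigma.mk.inj h).2

/-- Hoeffding's inequality: each centred summand ranges over an interval of length `w c`, hence is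
subgaussian with parameter `(w c / 2) ^ 2`; both tails are added. -/
lemma IsPercolation.measure_keptSum_sub_le (h : IsPercolation P p X) (hp : 0 ≤ p)
    (s : Finset (Address k (n + 1))) {w : Address k (n + 1) → ℝ} (hw : ∀ c, 0 ≤ w c)
    {D : ℝ} (hD : 0 ≤ D) :
    P {ω | D < |keptSum X s w ω - p * ∑ c ∈ s, w c|}
      ≤ ENNReal.ofReal (2 * Real.exp (-(2 * D ^ 2 / ∑ c ∈ s, w c ^ 2))) := by
  set Y : Address k (n + 1) → Ω → ℝ :=
    fun c ω => (if X ⟨n + 1, c⟩ ω = true then w c else 0) - p * w c with hY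
  have hYi : iIndepFun Y P := (h.iIndepFun_level (n + 1)).comp
    (fun c b => (if b = true then w c else 0) - p * w c) fun _ => measurable_from_top
  have hsub : ∀ c, HasSubgaussianMGF (Y c) ((‖w c - 0‖₊ / 2) ^ 2) P := by
    intro c
    have := hasSubgaussianMGF_of_mem_Icc (μ := P) (a := 0) (b := w c)
      (X := fun ω => if X ⟨n + 1, c⟩ ω = true then w c else 0)
      ((measurable_from_top (f := fun b : Bool => if b = true then w c else 0)).comp
        (h.measurable ⟨n + 1, c⟩)).aemeasurable
      (ae_of_all _ fun ω => by split_ifs <;> simp [hw c])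
    rw [h.integral_ite hp] at this
    simpa [hY] using this
  have hneg : iIndepFun (fun c => -Y c) P := hYi.comp (fun _ x => -x) fun _ => measurable_neg
  have e1 := HasSubgaussianMGF.measure_sum_ge_le_of_iIndepFun hYi (s := s)
    (fun c _ => hsub c) hD
  have e2 := HasSubgaussianMGF.measure_sum_ge_le_of_iIndepFun hneg (s := s)
    (fun c _ => (hsub c).neg) hD
  have hs : -D ^ 2 / (2 * ((∑ c ∈ s, (‖w c - 0‖₊ / 2) ^ 2 : ℝ≥0) : ℝ))
      = -(2 * D ^ 2 / ∑ c ∈ s, w c ^ 2) := by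
    push_cast
    have : ∀ c, (‖w c - 0‖ / 2) ^ 2 = w c ^ 2 / 4 := by
      intro c; rw [sub_zero, div_pow, Real.norm_eq_abs, sq_abs]; norm_num
    simp only [this]
    rw [← Finset.sum_div]
    rcases eq_or_ne (∑ c ∈ s, w c ^ 2) 0 with h0 | h0
    · simp [h0]
    · field_simp; norm_num
  rw [hs] at e1 e2
  have hsum : ∀ ω, ∑ c ∈ s, Y c ω = keptSum X s w ω - p * ∑ c ∈ s, w c := by
    intro ω
    simp [hY, keptSum, Finset.sum_sub_distrib, Finset.mul_sum]
  have hsub' : {ω | D < |keptSum X s w ω - p * ∑ c ∈ s, w c|}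
      ⊆ {ω | D ≤ ∑ c ∈ s, Y c ω} ∪ {ω | D ≤ ∑ c ∈ s, (-Y c) ω} := by
    intro ω hω
    simp only [Set.mem_ofPred_eq, ← hsum] at hω
    rcases lt_abs.1 hω with h1 | h1
    · exact Or.inl h1.le
    · right; simpa [Finset.sum_neg_distrib] using h1.le
  refine (measure_mono hsub').trans ((measure_union_le _ _).trans ?_)
  rw [two_mul, ENNReal.ofReal_add (Real.exp_pos _).le (Real.exp_pos _).le]
  refine add_le_add ?_ ?_
  · rw [← ofReal_measureReal]; exact ENNReal.ofReal_le_ofReal e1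
  · rw [← ofReal_measureReal]; exact ENNReal.ofReal_le_ofReal e2

/-- The normalised sum of the weights `w` over the children of the retained squares. -/
noncomputable def childrenSum (p : ℝ) (x : Config k) (n : ℕ) (w : Address k (n + 1) → ℝ) : ℝ :=
  (∑ c ∈ children (retainedSet x n), w c) / p ^ n

/-- The normalised sum of the weights `w` over the retained squares of level `n + 1`. -/
noncomputable def retainedSum (p : ℝ) (x : Config k) (n : ℕ) (w : Address k (n + 1) → ℝ) : ℝ :=
  (∑ c ∈ retainedSet x (n + 1), w c) / p ^ (n + 1)

/-- With V the sum of the weights, ∑ w² ≤ (max w) V ≤ 4AV / k^(n+1), and 4A(V/pⁿ) ≤ (A + V/pⁿ)². The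
summand `A` in the threshold is there for this last inequality: the exponent then no longer depends
on V. -/
lemma IsPercolation.measure_retainedSum_sub_le (h : IsPercolation P p X) (hp : 0 < p)
    (hk : 2 ≤ k) {γ : ℝ} (hγ : 0 < γ) {A : ℝ} {w : Address k (n + 1) → ℝ} (hw : ∀ c, 0 ≤ w c)
    (hwA : ∀ c, w c ≤ 4 * A / (k : ℝ) ^ (n + 1)) :
    P {ω | γ ^ n * (A + childrenSum p (config X ω) n w) <
        |retainedSum p (config X ω) n w - childrenSum p (config X ω) n w|}
      ≤ ENNReal.ofReal (2 * Real.exp (-(p ^ 2 * (k * p * γ ^ 2) ^ n))) := by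
  have hk0 : (0 : ℝ) < k := by positivity
  have hA : 0 ≤ A := by
    have hne : Nonempty (Fin k) := ⟨⟨0, by omega⟩⟩
    have c : Address k (n + 1) := Classical.arbitrary _
    have := (hw c).trans (hwA c)
    rw [le_div_iff₀ (by positivity)] at this
    linarith
  set D : Finset (Address k n) → ℝ :=
    fun S => p ^ (n + 1) * γ ^ n * (A + (∑ c ∈ children S, w c) / p ^ n) with hD
  have hV : ∀ S : Finset (Address k n), 0 ≤ ∑ c ∈ children S, w c :=
    fun S => Finset.sum_nonneg fun c _ => hw c
  have hD0 : ∀ S, 0 ≤ D S := fun S => by have := hV S; positivity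
  set B : Finset (Address k n) → Set Ω := fun S =>
    {ω | D S < |keptSum X (children S) w ω - p * ∑ c ∈ children S, w c|} with hB
  have key := h.measure_retainedSet_le n (B := B)
    (δ := ENNReal.ofReal (2 * Real.exp (-(p ^ 2 * (k * p * γ ^ 2) ^ n)))) ?_ ?_
  · refine le_trans (measure_mono fun ω hω => ?_) key
    simp only [Set.mem_ofPred_eq, hB, hD] at hω ⊢
    rw [← sum_retainedSet_succ]
    rw [childrenSum, retainedSum] at hω
    have : (∑ c ∈ retainedSet (config X ω) (n + 1), w c) / p ^ (n + 1)
        - (∑ c ∈ children (retainedSet (config X ω) n), w c) / p ^ n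
        = (∑ c ∈ retainedSet (config X ω) (n + 1), w c
          - p * ∑ c ∈ children (retainedSet (config X ω) n), w c) / p ^ (n + 1) := by
      rw [sub_div, pow_succ' p, mul_div_mul_left _ _ hp.ne']
    rw [this, abs_div, abs_of_pos (pow_pos hp _), lt_div_iff₀ (by positivity)] at hω
    linarith
  · intro S
    exact measurableSet_lt_abs_sub (measurable_keptSum (X := X) (children S) w) _ _
  · intro S
    -- If all weights vanish, division by zero turns the Hoeffding bound into the useless value 2;
    -- but then the sum does not fluctuate and the event is empty.
    rcases eq_or_lt_of_le (Finset.sum_nonneg fun c (_ : c ∈ children S) => sq_nonneg (w c))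
      with h0 | h0
    · have h1 : ∀ c ∈ children S, w c = 0 := fun c hc => by
        simpa using (Finset.sum_eq_zero_iff_of_nonneg (fun c _ => sq_nonneg (w c))).1 h0.symm c hc
      have : B S = ∅ := by
        ext ω
        have h2 : keptSum X (children S) w ω = 0 :=
          Finset.sum_eq_zero fun c hc => by simp [h1 c hc]
        simp [hB, h2, Finset.sum_eq_zero h1, hD0 S]
      simp [this]
    · refine (h.measure_keptSum_sub_le hp.le (children S) hw (hD0 S)).trans ?_
      gcongr
      rw [le_div_iff₀ h0]
      set V := ∑ c ∈ children S, w c with hVdef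
      have h2 : ∑ c ∈ children S, w c ^ 2 ≤ 4 * A / (k : ℝ) ^ (n + 1) * V := by
        rw [hVdef, Finset.mul_sum]
        refine Finset.sum_le_sum fun c _ => ?_
        rw [sq]
        exact mul_le_mul_of_nonneg_right (hwA c) (hw c)
      have h3 : 4 * (A * (V / p ^ n)) ≤ (A + V / p ^ n) ^ 2 := by nlinarith [sq_nonneg (A - V / p ^ n)]
      calc p ^ 2 * (k * p * γ ^ 2) ^ n * ∑ c ∈ children S, w c ^ 2
          ≤ p ^ 2 * (k * p * γ ^ 2) ^ n * (4 * A / (k : ℝ) ^ (n + 1) * V) := by gcongr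
        _ = (p ^ (n + 1) * γ ^ n) ^ 2 * (4 * (A * (V / p ^ n))) / k := by
            field_simp
            ring
        _ ≤ (p ^ (n + 1) * γ ^ n) ^ 2 * (4 * (A * (V / p ^ n))) / 1 := by
            have := hV S
            gcongr
            exact_mod_cast (by omega : 1 ≤ k)
        _ ≤ 2 * D S ^ 2 := by
            rw [div_one, hD]
            simp only [mul_pow _ (A + _)]
            nlinarith [mul_le_mul_of_nonneg_left h3 (sq_nonneg (p ^ (n + 1) * γ ^ n)),
              mul_nonneg (sq_nonneg (p ^ (n + 1) * γ ^ n)) (sq_nonneg (A + V / p ^ n))]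

/-- From exp x ≥ x^m / m!, the exponential is O(β^(-mn)); choosing m with β^m > 2K + 1 leaves a
geometric series of ratio 1/2. -/
lemma summable_pow_mul_exp_neg_pow (C K c : ℝ) {β : ℝ} (hC : 0 ≤ C) (hK : 0 ≤ K) (hc : 0 < c)
    (hβ : 1 < β) : Summable fun n : ℕ => C * K ^ n * (2 * Real.exp (-(c * β ^ n))) := by
  obtain ⟨m, hm⟩ := pow_unbounded_of_one_lt (2 * K + 1) hβ
  have hm0 : 0 < β ^ m := by positivity
  refine Summable.of_nonneg_of_le (fun n => by positivity) (fun n => ?_)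
    ((summable_geometric_of_lt_one (r := 1 / 2) (by norm_num) (by norm_num)).mul_left
      (2 * C * (m.factorial / c ^ m)))
  have h1 : Real.exp (-(c * β ^ n)) ≤ m.factorial / (c * β ^ n) ^ m := by
    rw [Real.exp_neg, ← one_div, div_le_div_iff₀ (Real.exp_pos _) (by positivity), one_mul]
    have := Real.pow_div_factorial_le_exp (c * β ^ n) (by positivity) m
    rw [div_le_iff₀ (by positivity)] at this
    linarith
  have h2 : K ^ n / (β ^ m) ^ n ≤ (1 / 2) ^ n := by
    rw [← div_pow]
    refine pow_le_pow_left₀ (by positivity) ?_ n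
    rw [div_le_div_iff₀ hm0 (by norm_num)]
    linarith
  calc C * K ^ n * (2 * Real.exp (-(c * β ^ n)))
      ≤ C * K ^ n * (2 * (m.factorial / (c * β ^ n) ^ m)) := by gcongr
    _ = 2 * C * (m.factorial / c ^ m) * (K ^ n / (β ^ m) ^ n) := by
        rw [mul_pow, ← pow_mul, ← pow_mul, mul_comm n m]; field_simp
    _ ≤ _ := by gcongr

/-- Almost surely, from some level on, all members of a finite family of weights, whose
cardinality grows at most exponentially with the level, have small fluctuations. -/
lemma IsPercolation.ae_eventually_retainedSum (h : IsPercolation P p X) (hp : 0 < p) (hk : 2 ≤ k)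
    {γ : ℝ} (hγ : 0 < γ) (hβ : 1 < k * p * γ ^ 2) {C K : ℝ} (hC : 0 ≤ C) (hK : 0 ≤ K)
    (W : ∀ n, Finset (ℝ × (Address k (n + 1) → ℝ))) (hW : ∀ n, ((W n).card : ℝ) ≤ C * K ^ n)
    (hW0 : ∀ n, ∀ q ∈ W n, ∀ c, 0 ≤ q.2 c)
    (hWA : ∀ n, ∀ q ∈ W n, ∀ c, q.2 c ≤ 4 * q.1 / (k : ℝ) ^ (n + 1)) :
    ∀ᵐ ω ∂P, ∀ᶠ n in atTop, ∀ q ∈ W n,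
      |retainedSum p (config X ω) n q.2 - childrenSum p (config X ω) n q.2|
        ≤ γ ^ n * (q.1 + childrenSum p (config X ω) n q.2) := by
  have hbound : ∀ n, P (⋃ q ∈ W n, {ω | γ ^ n * (q.1 + childrenSum p (config X ω) n q.2) <
        |retainedSum p (config X ω) n q.2 - childrenSum p (config X ω) n q.2|})
      ≤ ENNReal.ofReal (C * K ^ n * (2 * Real.exp (-(p ^ 2 * (k * p * γ ^ 2) ^ n)))) := by
    intro n
    refine (measure_biUnion_finset_le _ _).trans ((Finset.sum_le_sum fun q hq =>
      h.measure_retainedSum_sub_le hp hk hγ (hW0 n q hq) (hWA n q hq)).trans ?_)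
    rw [Finset.sum_const, nsmul_eq_mul, ← ENNReal.ofReal_natCast, ← ENNReal.ofReal_mul (by simp)]
    exact ENNReal.ofReal_le_ofReal (mul_le_mul_of_nonneg_right (hW n) (by positivity))
  have hsum := ne_top_of_le_ne_top (summable_pow_mul_exp_neg_pow C K (p ^ 2) hC hK
    (by positivity) hβ).tsum_ofReal_ne_top (ENNReal.tsum_le_tsum hbound)
  filter_upwards [ae_eventually_notMem hsum] with ω hω
  filter_upwards [hω] with n hn q hq
  simp only [Set.mem_iUnion, not_exists, Set.mem_ofPred_eq, not_lt] at hn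
  exact hn q hq

end Deviation

/-! ### The trapezoidal kernel of a projected rectangle. -/

section Kernel

/-- The mixed second difference of the positive part. For `a * b ≠ 0`, the function
`kernel a b / (a * b)` is the density of the image of the Lebesgue measure on the unit square under
`(x, y) ↦ a * x + b * y`. -/
noncomputable def kernel (a b t : ℝ) : ℝ :=
  max t 0 - max (t - a) 0 - max (t - b) 0 + max (t - a - b) 0

lemma kernel_comm (a b t : ℝ) : kernel a b t = kernel b a t := by
  simp only [kernel, sub_right_comm t a b]; ring

/-- Reversing a side only shifts the kernel and changes its sign, so positivity for `a, b ≥ 0` shows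
that in general the kernel has the sign of `a * b`. -/
lemma kernel_neg_left (a b t : ℝ) : kernel (-a) b t = -kernel a b (t + a) := by
  simp only [kernel, sub_neg_eq_add, add_sub_cancel_right]; ring_nf

lemma kernel_zero_left (b t : ℝ) : kernel 0 b t = 0 := by
  simp [kernel]

lemma kernel_nonneg {a b : ℝ} (ha : 0 ≤ a) (hb : 0 ≤ b) (t : ℝ) : 0 ≤ kernel a b t := by
  rw [kernel]
  rcases max_cases t 0 with h1 | h1 <;> rcases max_cases (t - a) 0 with h2 | h2 <;>
    rcases max_cases (t - b) 0 with h3 | h3 <;> rcases max_cases (t - a - b) 0 with h4 | h4 <;>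
    linarith

lemma mul_kernel_nonneg_of_nonneg_right (a : ℝ) {b : ℝ} (hb : 0 ≤ b) (t : ℝ) :
    0 ≤ a * kernel a b t := by
  rcases le_total 0 a with ha | ha
  · exact mul_nonneg ha (kernel_nonneg ha hb t)
  · rw [← neg_neg a, kernel_neg_left, neg_mul_neg]
    exact mul_nonneg (by linarith) (kernel_nonneg (by linarith) hb _)

lemma mul_kernel_nonneg (a b t : ℝ) : 0 ≤ a * b * kernel a b t := by
  rcases le_total 0 b with hb | hb
  · have := mul_nonneg hb (mul_kernel_nonneg_of_nonneg_right a hb t)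
    linarith
  · rw [kernel_comm, ← neg_neg b, kernel_neg_left, kernel_comm]
    have := mul_nonneg (neg_nonneg.2 hb)
      (mul_kernel_nonneg_of_nonneg_right a (neg_nonneg.2 hb) (t + -b))
    linarith

lemma abs_pos_part_sub_le (x y : ℝ) : |max x 0 - max y 0| ≤ |x - y| :=
  (abs_max_sub_max_le_abs x y 0)

lemma abs_kernel_le_left (a b t : ℝ) : |kernel a b t| ≤ 2 * |a| := by
  have h1 := abs_pos_part_sub_le t (t - a)
  have h2 := abs_pos_part_sub_le (t - b) (t - a - b)
  rw [show t - (t - a) = a by ring] at h1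
  rw [show t - b - (t - a - b) = a by ring] at h2
  rw [kernel]
  rw [abs_le] at h1 h2 ⊢
  constructor <;> linarith

lemma abs_kernel_le_right (a b t : ℝ) : |kernel a b t| ≤ 2 * |b| := by
  rw [kernel_comm]; exact abs_kernel_le_left b a t

lemma abs_kernel_sub_le (a b t a' b' t' : ℝ) :
    |kernel a b t - kernel a' b' t'| ≤ 4 * |t - t'| + 2 * |a - a'| + 2 * |b - b'| := by
  have h1 := abs_pos_part_sub_le t t'
  have h2 := (abs_pos_part_sub_le (t - a) (t' - a')).trans
    (show _ ≤ |t - t'| + |a - a'| by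
      rw [show t - a - (t' - a') = (t - t') - (a - a') by ring]; exact abs_sub _ _)
  have h3 := (abs_pos_part_sub_le (t - b) (t' - b')).trans
    (show _ ≤ |t - t'| + |b - b'| by
      rw [show t - b - (t' - b') = (t - t') - (b - b') by ring]; exact abs_sub _ _)
  have h4 := (abs_pos_part_sub_le (t - a - b) (t' - a' - b')).trans
    (show _ ≤ |t - t'| + |a - a'| + |b - b'| by
      rw [show t - a - b - (t' - a' - b') = (t - t') - (a - a') - (b - b') by ring]
      exact (abs_sub _ _).trans (add_le_add_left (abs_sub _ _) _))
  simp only [kernel]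
  rw [abs_le] at h1 h2 h3 h4 ⊢
  constructor <;> linarith

lemma continuous_kernel (a b : ℝ) : Continuous (kernel a b) := by
  unfold kernel; fun_prop

lemma kernel_eq_zero_of_lt {a b t : ℝ} (h : |a| + |b| < |t|) : kernel a b t = 0 := by
  have ha := abs_le.1 (le_refl |a|)
  have hb := abs_le.1 (le_refl |b|)
  have ha0 := abs_nonneg a
  have hb0 := abs_nonneg b
  rw [kernel]
  rcases lt_abs.1 h with h | h
  · rw [max_eq_left, max_eq_left, max_eq_left, max_eq_left] <;> linarith
  · rw [max_eq_right, max_eq_right, max_eq_right, max_eq_right] <;> linarith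

/-- The kernel is a first difference in the `a` direction, so translates by multiples of `a`
telescope, whatever the signs. -/
lemma sum_kernel (a b t : ℝ) (m : ℕ) :
    ∑ i ∈ Finset.range m, kernel a b (t - i * a) = kernel (m * a) b t := by
  have h : ∀ i : ℕ, kernel a b (t - i * a)
      = (max (t - i * a) 0 - max (t - i * a - b) 0)
        - (max (t - (i + 1 : ℕ) * a) 0 - max (t - (i + 1 : ℕ) * a - b) 0) := by
    intro i
    simp only [kernel]
    push_cast
    ring_nf
  simp only [h]
  rw [Finset.sum_range_sub' (fun i : ℕ => max (t - i * a) 0 - max (t - i * a - b) 0)]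
  simp only [kernel]
  push_cast
  ring_nf

lemma sum_sum_kernel (a b t : ℝ) (k : ℕ) :
    ∑ i : Fin k, ∑ j : Fin k, kernel a b (t - (i * a + j * b)) = kernel (k * a) (k * b) t := by
  have h : ∀ i : Fin k, ∑ j : Fin k, kernel a b (t - (i * a + j * b))
      = kernel a (k * b) (t - i * a) := by
    intro i
    rw [Fin.sum_univ_eq_sum_range (fun j : ℕ => kernel a b (t - (i * a + j * b))) k,
      kernel_comm, ← sum_kernel]
    refine Finset.sum_congr rfl fun j _ => ?_
    rw [kernel_comm, sub_sub]
  simp only [h]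
  rw [Fin.sum_univ_eq_sum_range (fun i : ℕ => kernel a (k * b) (t - i * a)) k, sum_kernel]

lemma hasDerivAt_sq_pos_part (c t : ℝ) :
    HasDerivAt (fun t => max (t - c) 0 ^ 2 / 2) (max (t - c) 0) t := by
  rcases lt_trichotomy t c with h | h | h
  · have : (fun t => max (t - c) 0 ^ 2 / 2) =ᶠ[𝓝 t] fun _ => 0 := by
      filter_upwards [Iio_mem_nhds h] with s hs
      rw [max_eq_right (by simp only [Set.mem_Iio] at hs; linarith)]; simp
    rw [max_eq_right (by linarith)]
    exact (hasDerivAt_const t (0 : ℝ)).congr_of_eventuallyEq this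
  · subst h
    rw [sub_self, max_self, hasDerivAt_iff_isLittleO_nhds_zero]
    refine Asymptotics.IsBigO.trans_isLittleO (g := fun h : ℝ => h ^ 2) ?_ ?_
    · refine Asymptotics.IsBigO.of_bound 1 (Eventually.of_forall fun h => ?_)
      have h1 := abs_pos_part_sub_le h 0
      simp only [max_self, sub_zero] at h1
      simp only [add_sub_cancel_left, sub_self, max_self, smul_zero, sub_zero, norm_pow,
        Real.norm_eq_abs, one_mul]
      have := pow_le_pow_left₀ (abs_nonneg _) h1 2
      rw [sq_abs] at this
      norm_num
      rw [abs_of_nonneg (by positivity), ← sq_abs h]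
      linarith [sq_nonneg |h|]
    · simpa using Asymptotics.isLittleO_pow_id (𝕜 := ℝ) (n := 2) (by norm_num)
  · have : (fun t => max (t - c) 0 ^ 2 / 2) =ᶠ[𝓝 t] fun t => (t - c) ^ 2 / 2 := by
      filter_upwards [Ioi_mem_nhds h] with s hs
      rw [max_eq_left (by simp only [Set.mem_Ioi] at hs; linarith)]
    rw [max_eq_left (by linarith)]
    have h1 : HasDerivAt (fun t => (t - c) ^ 2 / 2) (t - c) t := by
      have := (((hasDerivAt_id t).sub_const c).pow 2).div_const 2
      exact this.congr_deriv (by simp)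
    exact h1.congr_of_eventuallyEq this

lemma hasCompactSupport_kernel (a b : ℝ) : HasCompactSupport (kernel a b) := by
  refine HasCompactSupport.intro (K := Set.Icc (-(|a| + |b|)) (|a| + |b|)) isCompact_Icc
    fun t ht => kernel_eq_zero_of_lt ?_
  by_contra h
  exact ht (abs_le.1 (not_lt.1 h))

lemma integrable_kernel (a b : ℝ) : Integrable (kernel a b) :=
  (continuous_kernel a b).integrable_of_hasCompactSupport (hasCompactSupport_kernel a b)

lemma integral_kernel (a b : ℝ) : ∫ t, kernel a b t = a * b := by
  have ha := abs_le.1 (le_refl |a|)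
  have hb := abs_le.1 (le_refl |b|)
  have ha0 := abs_nonneg a
  have hb0 := abs_nonneg b
  set M := |a| + |b| + 1 with hM
  have h1 : ∫ t, kernel a b t = ∫ t in (-M)..M, kernel a b t := by
    rw [intervalIntegral.integral_of_le (by linarith), ← integral_Icc_eq_integral_Ioc,
      setIntegral_eq_integral_of_forall_compl_eq_zero]
    intro t ht
    refine kernel_eq_zero_of_lt (lt_of_lt_of_le (by linarith : _ < M) ?_)
    by_contra h
    exact ht (abs_le.1 (not_le.1 h).le)
  -- The primitive is the second difference of (t₊)² / 2: it vanishes to the left of the support and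
  -- equals ab to the right of it.
  have h2 : ∀ t, HasDerivAt (fun t => max (t - 0) 0 ^ 2 / 2 - max (t - a) 0 ^ 2 / 2
      - max (t - b) 0 ^ 2 / 2 + max (t - (a + b)) 0 ^ 2 / 2) (kernel a b t) t := by
    intro t
    have := (((hasDerivAt_sq_pos_part 0 t).sub (hasDerivAt_sq_pos_part a t)).sub
      (hasDerivAt_sq_pos_part b t)).add (hasDerivAt_sq_pos_part (a + b) t)
    rw [← sub_sub, sub_zero] at this
    exact this
  rw [h1, intervalIntegral.integral_eq_sub_of_hasDerivAt (fun t _ => h2 t)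
    ((continuous_kernel a b).intervalIntegrable _ _)]
  rw [max_eq_left, max_eq_left, max_eq_left, max_eq_left, max_eq_right, max_eq_right,
    max_eq_right, max_eq_right]
  · ring
  all_goals linarith

end Kernel

/-! ### Kernels of k-adic squares. -/

section AddressKernel

variable {k n : ℕ}

/-- The kernel of the square with address `c`: after division by `a * b` it is the density of the
image of the Lebesgue measure on this square under `(x, y) ↦ a * x + b * y`. -/
noncomputable def addressKernel (a b : ℝ) (c : Address k n) (t : ℝ) : ℝ :=
  kernel (a / (k : ℝ) ^ n) (b / (k : ℝ) ^ n) (t - (a * leftEnd c.1 + b * leftEnd c.2))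

lemma sum_addressKernel_child (hk : 2 ≤ k) (a b : ℝ) (d : Address k n) (t : ℝ) :
    ∑ i, ∑ j, addressKernel a b (child d i j) t = addressKernel a b d t := by
  have hk0 : (0 : ℝ) < k := by positivity
  have h1 : ∀ x : ℝ, x / (k : ℝ) ^ n = k * (x / (k : ℝ) ^ (n + 1)) := by
    intro x; field_simp; ring
  rw [addressKernel, h1 a, h1 b, ← sum_sum_kernel]
  refine Finset.sum_congr rfl fun i _ => Finset.sum_congr rfl fun j _ => ?_
  rw [addressKernel, child, leftEnd_snoc, leftEnd_snoc]
  congr 1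
  ring

lemma mul_addressKernel_nonneg (a b : ℝ) (c : Address k n) (t : ℝ) :
    0 ≤ a * b * addressKernel a b c t := by
  -- For `k = 0` and `n > 0` the divisions by `k ^ n` are by zero and the kernel degenerates to 0.
  rcases Nat.eq_zero_or_pos k with rfl | hk
  · have := mul_kernel_nonneg (a / ((0 : ℕ) : ℝ) ^ n) (b / ((0 : ℕ) : ℝ) ^ n)
      (t - (a * leftEnd c.1 + b * leftEnd c.2))
    rcases Nat.eq_zero_or_pos n with rfl | hn
    · simpa [addressKernel] using this
    · simp [addressKernel, zero_pow hn.ne', kernel_zero_left]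
  have hk0 : (0 : ℝ) < k := by positivity
  have := mul_kernel_nonneg (a / (k : ℝ) ^ n) (b / (k : ℝ) ^ n)
    (t - (a * leftEnd c.1 + b * leftEnd c.2))
  rw [div_mul_div_comm, div_mul_eq_mul_div] at this
  have h2 := (le_div_iff₀ (by positivity)).1 this
  simpa [addressKernel] using h2

/-- All kernels have the sign of `a * b`, so absolute values inherit additivity. This conservation
law makes the projected densities a martingale. -/
lemma sum_abs_addressKernel_child (hk : 2 ≤ k) (a b : ℝ) (d : Address k n) (t : ℝ) :
    ∑ i, ∑ j, |addressKernel a b (child d i j) t| = |addressKernel a b d t| := by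
  rcases lt_trichotomy (a * b) 0 with h | h | h
  · have h1 : ∀ {m : ℕ} (c : Address k m), |addressKernel a b c t| = -addressKernel a b c t :=
      fun c => abs_of_nonpos (by nlinarith [mul_addressKernel_nonneg a b c t])
    simp only [h1, Finset.sum_neg_distrib, sum_addressKernel_child hk]
  · have h1 : ∀ {m : ℕ} (c : Address k m), addressKernel a b c t = 0 := by
      intro m c
      rcases mul_eq_zero.1 h with h | h
      · simp [addressKernel, h, kernel_zero_left]
      · simp [addressKernel, h, kernel_comm _ 0, kernel_zero_left]
    simp [h1]
  · have h1 : ∀ {m : ℕ} (c : Address k m), |addressKernel a b c t| = addressKernel a b c t :=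
      fun c => abs_of_nonneg (by nlinarith [mul_addressKernel_nonneg a b c t])
    simp only [h1, sum_addressKernel_child hk]

/-- The 6 is 2 + 4: a change of `a` alters the side, with Lipschitz constant 2, and moves the base
point by at most as much, with constant 4. -/
lemma abs_addressKernel_sub_le (hk : 2 ≤ k) (a b t a' b' t' : ℝ) (c : Address k n) :
    |addressKernel a b c t - addressKernel a' b' c t'|
      ≤ 4 * |t - t'| + 6 * |a - a'| + 6 * |b - b'| := by
  have hk1 : (1 : ℝ) ≤ (k : ℝ) ^ n := one_le_pow₀ (by exact_mod_cast (by omega : 1 ≤ k))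
  have hdiv : ∀ x y : ℝ, |x / (k : ℝ) ^ n - y / (k : ℝ) ^ n| ≤ |x - y| := by
    intro x y
    rw [← sub_div, abs_div, abs_of_pos (by positivity : (0 : ℝ) < (k : ℝ) ^ n)]
    exact div_le_self (abs_nonneg _) hk1
  have hmul : ∀ (x y : ℝ) (i : Fin n → Fin k), |(x - y) * leftEnd i| ≤ |x - y| := by
    intro x y i
    rw [abs_mul, abs_of_nonneg (leftEnd_nonneg i)]
    exact mul_le_of_le_one_right (abs_nonneg _) (leftEnd_le_one hk i)
  refine (abs_kernel_sub_le _ _ _ _ _ _).trans ?_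
  have h1 : |t - (a * leftEnd c.1 + b * leftEnd c.2) - (t' - (a' * leftEnd c.1 + b' * leftEnd c.2))|
      ≤ |t - t'| + |a - a'| + |b - b'| := by
    rw [show t - (a * leftEnd c.1 + b * leftEnd c.2) - (t' - (a' * leftEnd c.1 + b' * leftEnd c.2))
      = (t - t') - (a - a') * leftEnd c.1 - (b - b') * leftEnd c.2 by ring]
    exact (abs_sub _ _).trans (add_le_add ((abs_sub _ _).trans (add_le_add le_rfl (hmul _ _ _)))
      (hmul _ _ _))
  linarith [hdiv a a', hdiv b b']

/-- The height is at most 2 min(|a|, |b|) / kⁿ, and the minimum is at most 2|ab| once one of the two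
is at least 1/2. The factor |ab| is what the deviation bound requires of the weights with `A = |a *
b|`. -/
lemma abs_addressKernel_le (hk : 2 ≤ k) {a b : ℝ} (h : 1 / 2 ≤ |a| ∨ 1 / 2 ≤ |b|)
    (c : Address k n) (t : ℝ) : |addressKernel a b c t| ≤ 4 * |a * b| / (k : ℝ) ^ n := by
  have hk0 : (0 : ℝ) < (k : ℝ) ^ n := by positivity
  have e1 := abs_kernel_le_left (a / (k : ℝ) ^ n) (b / (k : ℝ) ^ n)
    (t - (a * leftEnd c.1 + b * leftEnd c.2))
  have e2 := abs_kernel_le_right (a / (k : ℝ) ^ n) (b / (k : ℝ) ^ n)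
    (t - (a * leftEnd c.1 + b * leftEnd c.2))
  rw [abs_div, abs_of_pos hk0] at e1 e2
  rw [abs_mul]
  rcases h with h | h
  · refine e2.trans ?_
    rw [mul_div_assoc', div_le_div_iff_of_pos_right hk0]
    nlinarith [abs_nonneg b]
  · refine e1.trans ?_
    rw [mul_div_assoc', div_le_div_iff_of_pos_right hk0]
    nlinarith [abs_nonneg a]

lemma addressKernel_eq_zero_of_lt (hk : 2 ≤ k) {a b t : ℝ} (ha : |a| ≤ 1) (hb : |b| ≤ 1)
    (c : Address k n) (h : 2 / (k : ℝ) ^ n < |t - (a * leftEnd c.1 + b * leftEnd c.2)|) :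
    addressKernel a b c t = 0 := by
  have hk0 : (0 : ℝ) < (k : ℝ) ^ n := by positivity
  refine kernel_eq_zero_of_lt (lt_of_le_of_lt ?_ h)
  rw [abs_div, abs_div, abs_of_pos hk0, ← add_div]
  gcongr
  linarith

lemma abs_mul_leftEnd_add_le (hk : 2 ≤ k) {a b : ℝ} (ha : |a| ≤ 1) (hb : |b| ≤ 1)
    (c : Address k n) : |a * leftEnd c.1 + b * leftEnd c.2| ≤ 2 := by
  refine (abs_add_le _ _).trans ?_
  rw [abs_mul, abs_mul, abs_of_nonneg (leftEnd_nonneg c.1), abs_of_nonneg (leftEnd_nonneg c.2)]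
  nlinarith [leftEnd_le_one hk c.1, leftEnd_le_one hk c.2, leftEnd_nonneg c.1, leftEnd_nonneg c.2]

end AddressKernel

/-! ### Projected densities of the approximations. -/

section ProjSum

variable {k : ℕ} {p : ℝ}

/-- Up to the factor `|a * b|`, the density of the image of `p⁻ⁿ Leb|_{E_n}` under
`(x, y) ↦ a * x + b * y`. -/
noncomputable def projSum (p : ℝ) (x : Config k) (n : ℕ) (a b t : ℝ) : ℝ :=
  (∑ c ∈ retainedSet x n, |addressKernel a b c t|) / p ^ n

lemma projSum_nonneg (hp : 0 < p) (x : Config k) (n : ℕ) (a b t : ℝ) : 0 ≤ projSum p x n a b t :=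
  div_nonneg (Finset.sum_nonneg fun _ _ => abs_nonneg _) (by positivity)

lemma childrenSum_abs_addressKernel (hk : 2 ≤ k) (x : Config k) (n : ℕ) (a b t : ℝ) :
    childrenSum p x n (fun c => |addressKernel a b c t|) = projSum p x n a b t := by
  rw [childrenSum, sum_children, projSum]
  simp only [sum_abs_addressKernel_child hk]

lemma abs_projSum_sub_le (hk : 2 ≤ k) (hp : 0 < p) (x : Config k) (n : ℕ) (a b t a' b' t' : ℝ) :
    |projSum p x n a b t - projSum p x n a' b' t'|
      ≤ ((k : ℝ) ^ 2 / p) ^ n * (4 * |t - t'| + 6 * |a - a'| + 6 * |b - b'|) := by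
  rw [projSum, projSum, ← sub_div, ← Finset.sum_sub_distrib, abs_div,
    abs_of_pos (pow_pos hp n), div_le_iff₀ (pow_pos hp n), div_pow]
  calc _ ≤ ∑ c ∈ retainedSet x n, (4 * |t - t'| + 6 * |a - a'| + 6 * |b - b'|) :=
        (Finset.abs_sum_le_sum_abs _ _).trans (Finset.sum_le_sum fun c _ =>
          (abs_abs_sub_abs_le_abs_sub _ _).trans (abs_addressKernel_sub_le hk _ _ _ _ _ _ c))
    _ ≤ ((k : ℝ) ^ 2) ^ n * (4 * |t - t'| + 6 * |a - a'| + 6 * |b - b'|) := by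
        rw [Finset.sum_const, nsmul_eq_mul]
        gcongr
        exact_mod_cast card_retainedSet_le x n
    _ = _ := by field_simp

lemma projSum_eq_zero_of_lt (hk : 2 ≤ k) (x : Config k) (n : ℕ) {a b t : ℝ} (ha : |a| ≤ 1)
    (hb : |b| ≤ 1) (ht : 4 < |t|) : projSum p x n a b t = 0 := by
  have hk1 : (1 : ℝ) ≤ (k : ℝ) ^ n := one_le_pow₀ (by exact_mod_cast (by omega : 1 ≤ k))
  rw [projSum, Finset.sum_eq_zero, zero_div]
  intro c _
  rw [addressKernel_eq_zero_of_lt hk ha hb c, abs_zero]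
  have h1 := abs_mul_leftEnd_add_le hk ha hb c
  have h2 : 2 / (k : ℝ) ^ n ≤ 2 := div_le_self (by norm_num) hk1
  have h3 := abs_sub_abs_le_abs_sub t (a * leftEnd c.1 + b * leftEnd c.2)
  linarith

/-- The points of the grid of mesh `1 / N` that approximate the points of `[-4, 4]`. -/
lemma exists_int_div_approx {N : ℕ} (hN : 0 < N) {x : ℝ} (hx : |x| ≤ 4) :
    ∃ i ∈ Finset.Icc (-(4 * N : ℤ)) (4 * N), |x - (i : ℝ) / N| ≤ 1 / N := by
  have hN0 : (0 : ℝ) < N := by exact_mod_cast hN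
  rw [abs_le] at hx
  have h1 := Int.floor_le (x * N)
  have h2 := Int.lt_floor_add_one (x * N)
  refine ⟨⌊x * N⌋, Finset.mem_Icc.2 ⟨Int.le_floor.2 ?_, ?_⟩, ?_⟩
  · push_cast; nlinarith
  · have : (⌊x * N⌋ : ℝ) ≤ (4 * N : ℝ) := by nlinarith
    exact_mod_cast this
  · have : x - (⌊x * N⌋ : ℝ) / N = (x * N - ⌊x * N⌋) / N := by field_simp
    rw [this, abs_div, abs_of_pos hN0, div_le_div_iff_of_pos_right hN0, abs_le]
    constructor <;> linarith

end ProjSum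

/-! ### Uniform control over all lines by a grid. -/

section Net

variable {Ω : Type*} [mΩ : MeasurableSpace Ω] {P : Measure Ω} [IsProbabilityMeasure P]
  {k : ℕ} {p : ℝ} {X : (Σ n : ℕ, Address k n) → Ω → Bool}

open scoped Classical in
/-- The weights given by the kernels of all lines of a fine grid. -/
noncomputable def gridWeights (k n : ℕ) : Finset (ℝ × (Address k (n + 1) → ℝ)) :=
  (((Finset.Icc (-(4 * (k ^ (4 * n) : ℕ) : ℤ)) (4 * (k ^ (4 * n) : ℕ))) ×ˢ
    (Finset.Icc (-(4 * (k ^ (4 * n) : ℕ) : ℤ)) (4 * (k ^ (4 * n) : ℕ))) ×ˢ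
    (Finset.Icc (-(4 * (k ^ (4 * n) : ℕ) : ℤ)) (4 * (k ^ (4 * n) : ℕ)))).image
    fun q => (|((q.1 : ℝ) / (k ^ (4 * n) : ℕ)) * ((q.2.1 : ℝ) / (k ^ (4 * n) : ℕ))|,
      fun c => |addressKernel ((q.1 : ℝ) / (k ^ (4 * n) : ℕ)) ((q.2.1 : ℝ) / (k ^ (4 * n) : ℕ)) c
        ((q.2.2 : ℝ) / (k ^ (4 * n) : ℕ))|)).filter
    fun w => (∀ c, 0 ≤ w.2 c) ∧ ∀ c, w.2 c ≤ 4 * w.1 / (k : ℝ) ^ (n + 1)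

lemma card_gridWeights_le (hk : 2 ≤ k) (n : ℕ) :
    ((gridWeights k n).card : ℝ) ≤ 729 * ((k : ℝ) ^ 12) ^ n := by
  have h1 : (gridWeights k n).card ≤ (8 * k ^ (4 * n) + 1) ^ 3 := by
    refine (Finset.card_filter_le _ _).trans (Finset.card_image_le.trans ?_)
    rw [Finset.card_product, Finset.card_product, Int.card_Icc]
    have : (4 * ((k ^ (4 * n) : ℕ) : ℤ) + 1 - -(4 * ((k ^ (4 * n) : ℕ) : ℤ))).toNat
        = 8 * k ^ (4 * n) + 1 := by omega
    rw [this]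
    exact le_of_eq (by ring)
  have h2 : 1 ≤ k ^ (4 * n) := Nat.one_le_pow _ _ (by omega)
  have h3 : (8 * k ^ (4 * n) + 1) ^ 3 ≤ (9 * k ^ (4 * n)) ^ 3 := Nat.pow_le_pow_left (by omega) 3
  calc ((gridWeights k n).card : ℝ) ≤ (((9 * k ^ (4 * n)) ^ 3 : ℕ) : ℝ) := by
        exact_mod_cast h1.trans h3
    _ = 729 * ((k : ℝ) ^ 12) ^ n := by
        push_cast
        rw [mul_pow, ← pow_mul, ← pow_mul]
        norm_num
        congr 1
        ring

/-- The probabilistic estimate holds on the grid and is carried to other lines by the Lipschitz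
bound. The transfer error, of order γⁿ, is absorbed in the additive constant, independent of the
line. -/
lemma IsPercolation.ae_eventually_projSum (h : IsPercolation P p X) (hk : 2 ≤ k) (hp : 0 < p)
    (hkp : 1 < k * p) {γ : ℝ} (hγk : 1 / k ≤ γ) (hγ1 : γ < 1) (hβ : 1 < k * p * γ ^ 2) :
    ∀ᵐ ω ∂P, ∀ᶠ n in atTop, ∀ a b t : ℝ, a ^ 2 + b ^ 2 = 1 →
      |projSum p (config X ω) (n + 1) a b t - projSum p (config X ω) n a b t|
        ≤ γ ^ n * (|a * b| + projSum p (config X ω) n a b t + 51 * (k : ℝ) ^ 3) := by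
  have hk0 : (0 : ℝ) < k := by positivity
  have hk1 : (1 : ℝ) ≤ k := by exact_mod_cast (by omega : 1 ≤ k)
  have hγ : 0 < γ := lt_of_lt_of_le (by positivity) hγk
  filter_upwards [h.ae_eventually_retainedSum hp hk hγ hβ (C := 729) (K := (k : ℝ) ^ 12)
    (by norm_num) (by positivity) (gridWeights k) (card_gridWeights_le hk)
    (fun n q hq => (Finset.mem_filter.1 hq).2.1) (fun n q hq => (Finset.mem_filter.1 hq).2.2)]
    with ω hω
  filter_upwards [hω, eventually_ge_atTop 1] with n hn hn1 a b t hab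
  have ha : |a| ≤ 1 := abs_le_one_iff_mul_self_le_one.2 (by nlinarith)
  have hb : |b| ≤ 1 := abs_le_one_iff_mul_self_le_one.2 (by nlinarith)
  set x := config X ω
  have hγn : 0 < γ ^ n := pow_pos hγ n
  rcases lt_or_ge 4 |t| with ht | ht
  · rw [projSum_eq_zero_of_lt hk x n ha hb ht, projSum_eq_zero_of_lt hk x (n + 1) ha hb ht]
    simp only [sub_self, abs_zero]
    positivity
  -- As p > 1/k, the Lipschitz constants at level n are O(k^(3n)); the mesh k^(-4n) makes the error
  -- O(k⁻ⁿ), and 1/k ≤ γ.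
  set N : ℕ := k ^ (4 * n) with hN
  have hN0 : 0 < N := Nat.pow_pos (by omega)
  obtain ⟨i, hi, hia⟩ := exists_int_div_approx hN0 (ha.trans (by norm_num))
  obtain ⟨j, hj, hjb⟩ := exists_int_div_approx hN0 (hb.trans (by norm_num))
  obtain ⟨l, hl, hlt⟩ := exists_int_div_approx hN0 ht
  set a' : ℝ := (i : ℝ) / N with ha'
  set b' : ℝ := (j : ℝ) / N with hb'
  set t' : ℝ := (l : ℝ) / N with ht'
  set δ : ℝ := 1 / N with hδ
  have hδk : δ = 1 / ((k : ℝ) ^ n) ^ 4 := by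
    rw [hδ, hN]; push_cast; rw [mul_comm 4 n, pow_mul]
  have hkn : 2 ≤ (k : ℝ) ^ n := by
    calc (2 : ℝ) ≤ (k : ℝ) ^ 1 := by rw [pow_one]; exact_mod_cast hk
      _ ≤ (k : ℝ) ^ n := pow_le_pow_right₀ hk1 hn1
  have hδ16 : δ ≤ 1 / 16 := by
    rw [hδk]
    apply one_div_le_one_div_of_le (by norm_num)
    calc (16 : ℝ) = 2 ^ 4 := by norm_num
      _ ≤ _ := by gcongr
  -- The grid direction is within 1/16 of a unit vector in each coordinate and 2(9/16)² < 1; hence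
  -- its weights pass the filter in `gridWeights`.
  have hmax : 1 / 2 ≤ |a'| ∨ 1 / 2 ≤ |b'| := by
    have h1 := abs_sub_abs_le_abs_sub a a'
    have h2 := abs_sub_abs_le_abs_sub b b'
    by_contra! hcon
    have h3 : |a| ≤ 9 / 16 := by linarith
    have h4 : |b| ≤ 9 / 16 := by linarith
    have h5 := pow_le_pow_left₀ (abs_nonneg _) h3 2
    have h6 := pow_le_pow_left₀ (abs_nonneg _) h4 2
    rw [sq_abs] at h5 h6
    linarith
  have hmem : (|a' * b'|, fun c : Address k (n + 1) => |addressKernel a' b' c t'|)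
      ∈ gridWeights k n := by
    classical
    refine Finset.mem_filter.2 ⟨Finset.mem_image.2 ⟨(i, j, l), ?_, rfl⟩,
      fun c => abs_nonneg _, fun c => abs_addressKernel_le hk hmax c t'⟩
    simp only [Finset.mem_product]
    exact ⟨hi, hj, hl⟩
  have hnet := hn _ hmem
  rw [childrenSum_abs_addressKernel hk] at hnet
  dsimp only at hnet
  change |projSum p x (n + 1) a' b' t' - projSum p x n a' b' t'| ≤ _ at hnet
  have hkp' : (k : ℝ) ^ 2 / p ≤ (k : ℝ) ^ 3 := by
    rw [div_le_iff₀ hp]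
    nlinarith [pow_pos hk0 2]
  have hLip : ∀ m : ℕ, |projSum p x m a b t - projSum p x m a' b' t'|
      ≤ ((k : ℝ) ^ 3) ^ m * (16 * δ) := by
    intro m
    refine (abs_projSum_sub_le hk hp x m _ _ _ _ _ _).trans ?_
    gcongr
    linarith
  have e1 : ((k : ℝ) ^ 3) ^ n * (16 * δ) = 16 * (1 / k) ^ n := by
    rw [hδk, ← pow_mul, mul_comm 3 n, pow_mul, div_pow, one_pow]
    field_simp
  have e2 : ((k : ℝ) ^ 3) ^ (n + 1) * (16 * δ) = 16 * (k : ℝ) ^ 3 * (1 / k) ^ n := by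
    rw [pow_succ, mul_right_comm, e1]; ring
  have hpow : (1 / k : ℝ) ^ n ≤ γ ^ n := pow_le_pow_left₀ (by positivity) hγk n
  have e3 : δ ≤ 1 := by linarith
  have hb'2 : |b'| ≤ 2 := by
    have := abs_sub_abs_le_abs_sub b' b
    rw [abs_sub_comm] at this
    linarith
  have e4 : |a' * b'| ≤ |a * b| + 3 := by
    have h1 : |a' * b'| ≤ |a * b| + |a| * |b - b'| + |b'| * |a - a'| := by
      rw [← abs_mul, ← abs_mul]
      calc |a' * b'| = |a * b - a * (b - b') - b' * (a - a')| := by congr 1; ring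
        _ ≤ _ := (abs_sub _ _).trans (add_le_add (abs_sub _ _) le_rfl)
    nlinarith [abs_nonneg a, abs_nonneg b', abs_nonneg (b - b'), abs_nonneg (a - a')]
  have f1 := hLip n
  have f2 := hLip (n + 1)
  rw [e1] at f1
  rw [e2] at f2
  have hk3 : (1 : ℝ) ≤ (k : ℝ) ^ 3 := one_le_pow₀ hk1
  have hpow1 : (1 / k : ℝ) ^ n ≤ 1 := pow_le_one₀ (by positivity) (by rw [div_le_one hk0]; exact hk1)
  set u := (1 / k : ℝ) ^ n
  have hu : 0 ≤ u := by positivity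
  have g1 : |projSum p x (n + 1) a b t - projSum p x n a b t|
      ≤ |projSum p x (n + 1) a' b' t' - projSum p x n a' b' t'| + 16 * (k : ℝ) ^ 3 * u + 16 * u := by
    calc _ = |(projSum p x (n + 1) a' b' t' - projSum p x n a' b' t')
          + (projSum p x (n + 1) a b t - projSum p x (n + 1) a' b' t')
          - (projSum p x n a b t - projSum p x n a' b' t')| := by congr 1; ring
      _ ≤ _ := (abs_sub _ _).trans (add_le_add ((abs_add_le _ _).trans (add_le_add le_rfl f2)) f1)
  have g2 : projSum p x n a' b' t' ≤ projSum p x n a b t + 16 := by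
    have := (abs_le.1 f1).1
    linarith
  -- Here 19 = 3 + 16 is the cost of replacing the grid line on the right-hand side; with the 32 for
  -- the two transfers on the left it makes 51.
  have g3 : γ ^ n * (|a' * b'| + projSum p x n a' b' t')
      ≤ γ ^ n * (|a * b| + projSum p x n a b t + 19 * (k : ℝ) ^ 3) :=
    mul_le_mul_of_nonneg_left (by linarith) hγn.le
  have g4 : 16 * (k : ℝ) ^ 3 * u + 16 * u ≤ γ ^ n * (32 * (k : ℝ) ^ 3) := by
    calc 16 * (k : ℝ) ^ 3 * u + 16 * u ≤ 16 * (k : ℝ) ^ 3 * u + 16 * (k : ℝ) ^ 3 * u := by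
          gcongr
          linarith
      _ = u * (32 * (k : ℝ) ^ 3) := by ring
      _ ≤ _ := by gcongr
  calc _ ≤ _ := g1
    _ ≤ γ ^ n * (|a * b| + projSum p x n a b t + 19 * (k : ℝ) ^ 3)
        + γ ^ n * (32 * (k : ℝ) ^ 3) := by linarith
    _ = _ := by ring

end Net

/-! ### Geometric convergence and Hölder regularity of limits. -/

section Regularity

/-- A discrete Grönwall inequality: 1 + u grows by factors 1 + Cγⁿ, whose product is at most exp(C /
(1 - γ)). -/
lemma one_add_le_mul_exp {u : ℕ → ℝ} {γ C : ℝ} (hγ : 0 ≤ γ) (hγ1 : γ < 1) (hC : 0 ≤ C)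
    (hu : ∀ n, 0 ≤ u n) {N : ℕ} (h : ∀ n ≥ N, u (n + 1) ≤ u n + C * γ ^ n * (1 + u n)) (m : ℕ) :
    1 + u (N + m) ≤ (1 + u N) * Real.exp (C / (1 - γ)) := by
  have h1 : ∀ m, 1 + u (N + m) ≤ (1 + u N) * Real.exp (C * ∑ i ∈ Finset.range m, γ ^ i) := by
    intro m
    induction m with
    | zero => simp
    | succ m ih =>
      have h2 := h (N + m) (by omega)
      have h3 : γ ^ (N + m) ≤ γ ^ m := pow_le_pow_of_le_one hγ hγ1.le (by omega)
      have h4 : 1 + C * γ ^ (N + m) ≤ Real.exp (C * γ ^ m) := by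
        have := Real.add_one_le_exp (C * γ ^ m)
        nlinarith
      rw [Finset.sum_range_succ, mul_add, Real.exp_add, ← mul_assoc]
      calc 1 + u (N + (m + 1)) ≤ (1 + u (N + m)) * (1 + C * γ ^ (N + m)) := by
            rw [← add_assoc]; linarith
        _ ≤ _ := mul_le_mul ih h4 (by positivity)
            (mul_nonneg (by linarith [hu N]) (Real.exp_pos _).le)
  refine (h1 m).trans (mul_le_mul_of_nonneg_left ?_ (by linarith [hu N]))
  refine Real.exp_le_exp.2 ?_
  rw [div_eq_mul_inv, ← tsum_geometric_of_lt_one hγ hγ1]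
  exact mul_le_mul_of_nonneg_left ((summable_geometric_of_lt_one hγ hγ1).sum_le_tsum _
    fun _ _ => by positivity) hC

/-- If the increments of a sequence of nonnegative bounded functions are eventually at most
`C * γ ^ n * (1 + f n)`, then the sequence converges uniformly at a geometric rate. -/
lemma exists_geometric_limit {f : ℕ → ℝ → ℝ} (hf : ∀ n t, 0 ≤ f n t)
    (hbd : ∀ n, ∃ B, ∀ t, f n t ≤ B) {γ C : ℝ} (hγ : 0 < γ) (hγ1 : γ < 1) (hC : 0 ≤ C)
    (h : ∀ᶠ n in atTop, ∀ t, |f (n + 1) t - f n t| ≤ C * γ ^ n * (1 + f n t)) :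
    ∃ (g : ℝ → ℝ) (M : ℝ), (∀ t, 0 ≤ g t) ∧ (∀ t, g t ≤ M) ∧
      ∀ n t, |f n t - g t| ≤ M * γ ^ n := by
  choose B hB using hbd
  have hB0 : ∀ n, 0 ≤ B n := fun n => (hf n 0).trans (hB n 0)
  obtain ⟨N, hN⟩ := eventually_atTop.1 h
  set K := C * ((1 + B N) * Real.exp (C / (1 - γ))) with hK
  have hK0 : 0 ≤ K := by have := hB0 N; positivity
  -- The finite sum absorbs the levels below `N`, where only the crude bounds `B` are known.
  set D := K + ∑ n ∈ Finset.range N, (B (n + 1) + B n) / γ ^ n with hD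
  have hterm : ∀ n, 0 ≤ (B (n + 1) + B n) / γ ^ n := fun n => by
    have := hB0 n; have := hB0 (n + 1); positivity
  have hD0 : K ≤ D := le_add_of_nonneg_right (Finset.sum_nonneg fun n _ => hterm n)
  have hstep : ∀ n t, |f (n + 1) t - f n t| ≤ D * γ ^ n := by
    intro n t
    rcases le_or_gt N n with hn | hn
    · obtain ⟨m, rfl⟩ := Nat.exists_eq_add_of_le hn
      have h1 := one_add_le_mul_exp (u := fun n => f n t) hγ.le hγ1 hC (fun n => hf n t)
        (N := N) (fun n hn => by have := (abs_le.1 (hN n hn t)).2; linarith) m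
      have h2 := hN (N + m) (by omega) t
      calc _ ≤ C * γ ^ (N + m) * (1 + f (N + m) t) := h2
        _ ≤ C * γ ^ (N + m) * ((1 + B N) * Real.exp (C / (1 - γ))) := by
            refine mul_le_mul_of_nonneg_left (h1.trans ?_) (by positivity)
            exact mul_le_mul_of_nonneg_right (by linarith [hB N t]) (Real.exp_pos _).le
        _ = K * γ ^ (N + m) := by rw [hK]; ring
        _ ≤ _ := by gcongr
    · have h1 : |f (n + 1) t - f n t| ≤ B (n + 1) + B n := by
        rw [abs_le]
        constructor <;> linarith [hf n t, hf (n + 1) t, hB n t, hB (n + 1) t]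
      calc _ ≤ B (n + 1) + B n := h1
        _ = (B (n + 1) + B n) / γ ^ n * γ ^ n := by field_simp
        _ ≤ _ := by
          gcongr
          have := Finset.single_le_sum (f := fun n => (B (n + 1) + B n) / γ ^ n)
            (fun n _ => hterm n) (Finset.mem_range.2 hn)
          linarith
  have hdist : ∀ t n, dist (f n t) (f (n + 1) t) ≤ D * γ ^ n := fun t n => by
    rw [dist_comm, Real.dist_eq]; exact hstep n t
  choose g hg using fun t => cauchySeq_tendsto_of_complete
    (cauchySeq_of_le_geometric γ D hγ1 (hdist t))
  have hlim : ∀ n t, |f n t - g t| ≤ D / (1 - γ) * γ ^ n := fun n t => by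
    have := dist_le_of_le_geometric_of_tendsto γ D hγ1 (hdist t) (hg t) n
    rw [Real.dist_eq] at this
    exact this.trans_eq (by ring)
  have hpos : 0 ≤ D / (1 - γ) := div_nonneg (hK0.trans hD0) (by linarith)
  refine ⟨g, D / (1 - γ) + B 0, fun t => ge_of_tendsto' (hg t) fun n => hf n t, fun t => ?_,
    fun n t => (hlim n t).trans ?_⟩
  · have := (abs_le.1 (hlim 0 t)).1
    rw [pow_zero, mul_one] at this
    linarith [hB 0 t]
  · have := hB0 0
    gcongr
    linarith

/-- A uniform limit, at a geometric rate, of functions whose Lipschitz constants grow at most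
geometrically is Hölder continuous. -/
lemma holder_of_lipschitz_approx {f : ℕ → ℝ → ℝ} {g : ℝ → ℝ} {γ A M L α : ℝ} (hγ : 0 < γ)
    (hγA : γ < A) (hα : 0 ≤ α) (hαγ : (γ / A) ^ α = γ) (hM : 0 ≤ M) (hL : 0 ≤ L)
    (hg0 : ∀ t, 0 ≤ g t) (hgM : ∀ t, g t ≤ M)
    (hfg : ∀ n t, |f n t - g t| ≤ M * γ ^ n)
    (hf : ∀ n s t, |f n s - f n t| ≤ L * A ^ n * |s - t|) (s t : ℝ) :
    |g s - g t| ≤ (2 * M + L + M * γ) / γ * |s - t| ^ α := by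
  have hA : 0 < A := hγ.trans hγA
  rcases eq_or_ne s t with rfl | hst
  · rw [sub_self, abs_zero]; positivity
  have hd : 0 < |s - t| := abs_pos.2 (sub_ne_zero.2 hst)
  rcases le_or_gt |s - t| 1 with h1 | h1
  · obtain ⟨n, hn1, hn2⟩ := exists_nat_pow_near_of_lt_one hd h1 (div_pos hγ hA)
      ((div_lt_one hA).2 hγA)
    have h2 : γ ^ (n + 1) ≤ |s - t| ^ α := by
      calc γ ^ (n + 1) = ((γ / A) ^ (n + 1)) ^ α := by
            rw [← Real.rpow_natCast (γ / A), ← Real.rpow_mul (by positivity), mul_comm,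
              Real.rpow_mul (by positivity), hαγ, Real.rpow_natCast]
        _ ≤ _ := Real.rpow_le_rpow (by positivity) hn1.le hα
    have h3 : |g s - g t| ≤ M * γ ^ n + M * γ ^ n + L * A ^ n * |s - t| := by
      calc |g s - g t| = |(f n t - g t) - (f n s - g s) + (f n s - f n t)| := by congr 1; ring
        _ ≤ _ := (abs_add_le _ _).trans (add_le_add ((abs_sub _ _).trans
          (add_le_add (hfg n t) (hfg n s))) (hf n s t))
    have h4 : L * A ^ n * |s - t| ≤ L * γ ^ n := by
      calc L * A ^ n * |s - t| ≤ L * A ^ n * (γ / A) ^ n := by gcongr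
        _ = _ := by rw [div_pow]; field_simp
    calc |g s - g t| ≤ (2 * M + L) * γ ^ n := by linarith
      _ = (2 * M + L) / γ * γ ^ (n + 1) := by rw [pow_succ]; field_simp
      _ ≤ (2 * M + L + M * γ) / γ * |s - t| ^ α := by
          have h5 : (2 * M + L) / γ ≤ (2 * M + L + M * γ) / γ :=
            (div_le_div_iff_of_pos_right hγ).2 (le_add_of_nonneg_right (by positivity))
          exact mul_le_mul h5 h2 (by positivity) (by positivity)
  · have h2 : |g s - g t| ≤ M := by
      rw [abs_le]
      constructor <;> linarith [hg0 s, hg0 t, hgM s, hgM t]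
    have h3 : 1 ≤ |s - t| ^ α := Real.one_le_rpow h1.le hα
    calc |g s - g t| ≤ M * γ / γ * 1 := by rw [mul_one, mul_div_cancel_right₀ _ hγ.ne']; exact h2
      _ ≤ _ := by gcongr; linarith

/-- A uniform limit, at a geometric rate, of functions that are constant on the open `k`-adic
intervals of level `n` is Hölder continuous in the `k`-symbolic metric. -/
lemma symbolic_holder_of_locally_const {k : ℕ} (hk : 2 ≤ k) {f : ℕ → ℝ → ℝ} {g : ℝ → ℝ}
    {γ M α : ℝ} (hγ : 0 < γ) (hαγ : γ ≤ (1 / k : ℝ) ^ α) (hM : 0 ≤ M)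
    (hg0 : ∀ t, 0 ≤ g t) (hgM : ∀ t, g t ≤ M)
    (hfg : ∀ n t, |f n t - g t| ≤ M * γ ^ n)
    (hf : ∀ n s t, s ∉ kadicPoints k → t ∉ kadicPoints k →
      (¬ ∃ m : ℤ, min s t < (m : ℝ) / (k : ℝ) ^ n ∧ (m : ℝ) / (k : ℝ) ^ n < max s t) →
      f n s = f n t) {s t : ℝ} (hs : s ∉ kadicPoints k) (ht : t ∉ kadicPoints k) :
    |g s - g t| ≤ (2 * M / γ + M) * symbolicDist k s t ^ α := by
  have hk0 : (0 : ℝ) < k := by positivity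
  rcases eq_or_ne s t with rfl | hst
  · rw [sub_self, abs_zero, symbolicDist, if_pos rfl]
    positivity
  have hrho : symbolicDist k s t = (1 / k : ℝ) ^ (sInf {l : ℕ | ∃ m : ℤ,
      min s t < (m : ℝ) / (k : ℝ) ^ l ∧ (m : ℝ) / (k : ℝ) ^ l < max s t}) := by
    rw [symbolicDist, if_neg hst, mul_comm, ← mul_neg, Real.exp_nat_mul, Real.exp_neg,
      Real.exp_log hk0, one_div]
  rw [hrho]
  rcases hl : sInf {l : ℕ | ∃ m : ℤ,
      min s t < (m : ℝ) / (k : ℝ) ^ l ∧ (m : ℝ) / (k : ℝ) ^ l < max s t} with _ | n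
  -- The infimum 0 gives distance 1, so the trivial bound suffices; it also covers the default value
  -- of `sInf` on the empty set.
  · have h2 : |g s - g t| ≤ M := by
      rw [abs_le]
      constructor <;> linarith [hg0 s, hg0 t, hgM s, hgM t]
    rw [pow_zero, Real.one_rpow, mul_one]
    have : 0 ≤ 2 * M / γ := by positivity
    linarith
  -- Level `n` is the last one below the infimum: none of its grid points separates `s` from `t`.
  · have h1 := hf n s t hs ht (Nat.notMem_of_lt_sInf (lt_of_lt_of_eq n.lt_succ_self hl.symm))
    have h2 : |g s - g t| ≤ M * γ ^ n + M * γ ^ n := by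
      calc |g s - g t| = |(f n t - g t) - (f n s - g s)| := by rw [h1]; congr 1; ring
        _ ≤ _ := (abs_sub _ _).trans (add_le_add (hfg n t) (hfg n s))
    have h3 : γ ^ (n + 1) ≤ ((1 / k : ℝ) ^ (n + 1)) ^ α := by
      calc γ ^ (n + 1) ≤ ((1 / k : ℝ) ^ α) ^ (n + 1) := by gcongr
        _ = _ := by
          rw [← Real.rpow_natCast, ← Real.rpow_natCast, ← Real.rpow_mul (by positivity),
            ← Real.rpow_mul (by positivity), mul_comm]
    calc |g s - g t| ≤ 2 * M * γ ^ n := by linarith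
      _ = 2 * M / γ * γ ^ (n + 1) := by rw [pow_succ]; field_simp
      _ ≤ _ := by gcongr; linarith

end Regularity

/-! ### Kernels for the coordinate projections. -/

section IntervalKernel

variable {k n : ℕ}

/-- The indicator function of the half-open `k`-adic interval with address `i`, multiplied by the
length of this interval. -/
noncomputable def intervalKernel (i : Fin n → Fin k) (t : ℝ) : ℝ :=
  (Set.Ico (leftEnd i) (leftEnd i + 1 / (k : ℝ) ^ n)).indicator (fun _ => 1 / (k : ℝ) ^ n) t

lemma intervalKernel_nonneg (i : Fin n → Fin k) (t : ℝ) : 0 ≤ intervalKernel i t :=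
  Set.indicator_nonneg (fun _ _ => by positivity) t

lemma intervalKernel_le (i : Fin n → Fin k) (t : ℝ) : intervalKernel i t ≤ 1 / (k : ℝ) ^ n :=
  Set.indicator_le_self' (fun _ _ => by positivity) t

lemma intervalKernel_eq_step (i : Fin n → Fin k) (t : ℝ) :
    intervalKernel i t = ((Set.Ici (leftEnd i)).indicator 1 t
      - (Set.Ici (leftEnd i + 1 / (k : ℝ) ^ n)).indicator 1 t) / (k : ℝ) ^ n := by
  have h : leftEnd i ≤ leftEnd i + 1 / (k : ℝ) ^ n := by
    simp only [le_add_iff_nonneg_right]; positivity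
  simp only [intervalKernel, Set.indicator, Set.mem_Ico, Set.mem_Ici, Pi.one_apply]
  by_cases h1 : leftEnd i ≤ t
  · by_cases h2 : leftEnd i + 1 / (k : ℝ) ^ n ≤ t
    · rw [if_neg (by intro h3; linarith [h3.2]), if_pos h1, if_pos h2]; simp
    · rw [if_pos ⟨h1, not_le.1 h2⟩, if_pos h1, if_neg h2]; simp
  · rw [if_neg (by tauto), if_neg h1, if_neg (by intro h2; exact h1 (h.trans h2))]; simp

/-- The half-open subintervals tile exactly, so the step functions telescope at every point. The
factor 1/k is the ratio of heights; it is restored by the k children in each column or row. -/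
lemma sum_intervalKernel_snoc (hk : 2 ≤ k) (d : Fin n → Fin k) (t : ℝ) :
    ∑ i : Fin k, intervalKernel (Fin.snoc d i : Fin (n + 1) → Fin k) t
      = intervalKernel d t / k := by
  have hk0 : (0 : ℝ) < k := by positivity
  have h : ∀ i : Fin k, intervalKernel (Fin.snoc d i : Fin (n + 1) → Fin k) t
      = ((Set.Ici (leftEnd d + (i : ℕ) / (k : ℝ) ^ (n + 1))).indicator 1 t
      - (Set.Ici (leftEnd d + ((i : ℕ) + 1 : ℕ) / (k : ℝ) ^ (n + 1))).indicator 1 t)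
        / (k : ℝ) ^ (n + 1) := by
    intro i
    rw [intervalKernel_eq_step, leftEnd_snoc, add_assoc, ← add_div]
    push_cast
    rfl
  simp only [h]
  rw [← Finset.sum_div, Fin.sum_univ_eq_sum_range (fun i : ℕ =>
    ((Set.Ici (leftEnd d + (i : ℝ) / (k : ℝ) ^ (n + 1))).indicator (1 : ℝ → ℝ) t
      - (Set.Ici (leftEnd d + ((i + 1 : ℕ) : ℝ) / (k : ℝ) ^ (n + 1))).indicator 1 t)) k,
    Finset.sum_range_sub' (fun i : ℕ =>
      (Set.Ici (leftEnd d + (i : ℝ) / (k : ℝ) ^ (n + 1))).indicator (1 : ℝ → ℝ) t),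
    intervalKernel_eq_step, Nat.cast_zero, zero_div, add_zero, div_div, pow_succ]
  have : (k : ℝ) / ((k : ℝ) ^ n * k) = 1 / (k : ℝ) ^ n := by field_simp
  rw [this]

lemma exists_nat_leftEnd (hk : 2 ≤ k) (i : Fin n → Fin k) :
    ∃ m : ℕ, leftEnd i = (m : ℝ) / (k : ℝ) ^ n := by
  have hk0 : (0 : ℝ) < k := by positivity
  induction n with
  | zero => exact ⟨0, by simp [leftEnd]⟩
  | succ n ih =>
    obtain ⟨m, hm⟩ := ih (Fin.init i)
    refine ⟨m * k + i (Fin.last n), ?_⟩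
    rw [leftEnd_succ, hm]
    push_cast
    field_simp
    ring

lemma exists_nat_rightEnd (hk : 2 ≤ k) (i : Fin n → Fin k) :
    ∃ m : ℕ, leftEnd i + 1 / (k : ℝ) ^ n = (m : ℝ) / (k : ℝ) ^ n := by
  obtain ⟨m, hm⟩ := exists_nat_leftEnd hk i
  exact ⟨m + 1, by rw [hm, ← add_div]; push_cast; rfl⟩

lemma intervalKernel_congr (hk : 2 ≤ k) (i : Fin n → Fin k) {s t : ℝ}
    (h : ∀ m : ℕ, (m : ℝ) / (k : ℝ) ^ n ≤ s ↔ (m : ℝ) / (k : ℝ) ^ n ≤ t) :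
    intervalKernel i s = intervalKernel i t := by
  obtain ⟨m, hm⟩ := exists_nat_leftEnd hk i
  obtain ⟨l, hl⟩ := exists_nat_rightEnd hk i
  rw [intervalKernel_eq_step, intervalKernel_eq_step, hl, hm]
  simp only [Set.indicator, Set.mem_Ici, h m, h l]
  rfl

lemma intervalKernel_eq_zero_of_lt (hk : 2 ≤ k) (i : Fin n → Fin k) {t : ℝ} (ht : 4 < |t|) :
    intervalKernel i t = 0 := by
  refine Set.indicator_of_notMem (fun h => ?_) _
  have h1 := leftEnd_nonneg i
  have h2 := leftEnd_add_le_one hk i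
  rw [abs_of_nonneg (h1.trans h.1)] at ht
  linarith [h.2]

lemma integrable_intervalKernel (i : Fin n → Fin k) : Integrable (intervalKernel i) :=
  (integrable_indicator_iff measurableSet_Ico).2 (by simp)

lemma integral_intervalKernel (i : Fin n → Fin k) :
    ∫ t, intervalKernel i t = 1 / ((k : ℝ) ^ 2) ^ n := by
  have : (fun t => intervalKernel i t)
    = (Set.Ico (leftEnd i) (leftEnd i + 1 / (k : ℝ) ^ n)).indicator fun _ => 1 / (k : ℝ) ^ n := rfl
  rw [this, integral_indicator_const _ measurableSet_Ico, measureReal_def, Real.volume_Ico,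
    add_sub_cancel_left, ENNReal.toReal_ofReal (by positivity), smul_eq_mul, div_mul_div_comm,
    one_mul, ← mul_pow, sq]

end IntervalKernel

/-! ### Densities of the coordinate projections. -/

section Columns

variable {k : ℕ} {p : ℝ}

/-- The coordinate of an address: the address of the column for `b = false`, of the row for
`b = true`. -/
def coordWord {n : ℕ} (b : Bool) (c : Address k n) : Fin n → Fin k :=
  if b then c.2 else c.1

/-- The density of the image of `p⁻ⁿ Leb|_{E_n}` under a coordinate projection. -/
noncomputable def axisSum (p : ℝ) (x : Config k) (n : ℕ) (b : Bool) (t : ℝ) : ℝ :=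
  (∑ c ∈ retainedSet x n, intervalKernel (coordWord b c) t) / p ^ n

lemma axisSum_nonneg (hp : 0 < p) (x : Config k) (n : ℕ) (b : Bool) (t : ℝ) :
    0 ≤ axisSum p x n b t :=
  div_nonneg (Finset.sum_nonneg fun _ _ => intervalKernel_nonneg _ _) (by positivity)

lemma sum_intervalKernel_child (hk : 2 ≤ k) {n : ℕ} (b : Bool) (d : Address k n) (t : ℝ) :
    ∑ i, ∑ j, intervalKernel (coordWord b (child d i j)) t = intervalKernel (coordWord b d) t := by
  have hk0 : (0 : ℝ) < k := by positivity
  cases b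
  · simp only [coordWord, child, Bool.false_eq_true, if_false, Finset.sum_const, Finset.card_univ,
      Fintype.card_fin, nsmul_eq_mul, ← Finset.mul_sum]
    rw [sum_intervalKernel_snoc hk]; field_simp
  · simp only [coordWord, child, if_true, sum_intervalKernel_snoc hk, Finset.sum_const,
      Finset.card_univ, Fintype.card_fin, nsmul_eq_mul]
    field_simp

lemma childrenSum_intervalKernel (hk : 2 ≤ k) (x : Config k) (n : ℕ) (b : Bool) (t : ℝ) :
    childrenSum p x n (fun c => intervalKernel (coordWord b c) t) = axisSum p x n b t := by
  rw [childrenSum, sum_children, axisSum]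
  simp only [sum_intervalKernel_child hk]

lemma axisSum_eq_of_notMem_kadicPoints (hk : 2 ≤ k) (x : Config k) (n : ℕ) (b : Bool) {s t : ℝ}
    (hs : s ∉ kadicPoints k) (ht : t ∉ kadicPoints k)
    (h : ¬ ∃ m : ℤ, min s t < (m : ℝ) / (k : ℝ) ^ n ∧ (m : ℝ) / (k : ℝ) ^ n < max s t) :
    axisSum p x n b s = axisSum p x n b t := by
  have key : ∀ m : ℕ, (m : ℝ) / (k : ℝ) ^ n ≤ s ↔ (m : ℝ) / (k : ℝ) ^ n ≤ t := by
    intro m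
    have hs' : (m : ℝ) / (k : ℝ) ^ n ≠ s := fun h => hs ⟨m, n, by simp [← h]⟩
    have ht' : (m : ℝ) / (k : ℝ) ^ n ≠ t := fun h => ht ⟨m, n, by simp [← h]⟩
    constructor
    · intro h1
      by_contra h2
      exact h ⟨m, by simpa using Or.inr (not_le.1 h2), by simpa using Or.inl (lt_of_le_of_ne h1 hs')⟩
    · intro h1
      by_contra h2
      exact h ⟨m, by simpa using Or.inl (not_le.1 h2), by simpa using Or.inr (lt_of_le_of_ne h1 ht')⟩
  simp only [axisSum, intervalKernel_congr hk _ key]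

end Columns

/-! ### Uniform control for the coordinate projections. -/

section AxisNet

variable {Ω : Type*} [mΩ : MeasurableSpace Ω] {P : Measure Ω} [IsProbabilityMeasure P]
  {k : ℕ} {p : ℝ} {X : (Σ n : ℕ, Address k n) → Ω → Bool}

open scoped Classical in
/-- The weights given by the columns and the rows of level `n + 1`. -/
noncomputable def axisWeights (k n : ℕ) (b : Bool) : Finset (ℝ × (Address k (n + 1) → ℝ)) :=
  (Finset.Icc (-(4 * (k ^ (n + 1) : ℕ) : ℤ)) (4 * (k ^ (n + 1) : ℕ))).image
    fun i : ℤ => (1, fun c => intervalKernel (coordWord b c) ((i : ℝ) / (k ^ (n + 1) : ℕ)))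

lemma card_axisWeights_le (hk : 2 ≤ k) (n : ℕ) (b : Bool) :
    ((axisWeights k n b).card : ℝ) ≤ 9 * k * (k : ℝ) ^ n := by
  have h1 : (axisWeights k n b).card ≤ 9 * k ^ (n + 1) := by
    refine Finset.card_image_le.trans ?_
    rw [Int.card_Icc]
    have : 1 ≤ k ^ (n + 1) := Nat.one_le_pow _ _ (by omega)
    omega
  calc ((axisWeights k n b).card : ℝ) ≤ ((9 * k ^ (n + 1) : ℕ) : ℝ) := by exact_mod_cast h1
    _ = _ := by push_cast; ring

lemma IsPercolation.ae_eventually_axisSum (h : IsPercolation P p X) (hk : 2 ≤ k) (hp : 0 < p)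
    {γ : ℝ} (hγ : 0 < γ) (hβ : 1 < k * p * γ ^ 2) (b : Bool) :
    ∀ᵐ ω ∂P, ∀ᶠ n in atTop, ∀ t : ℝ,
      |axisSum p (config X ω) (n + 1) b t - axisSum p (config X ω) n b t|
        ≤ γ ^ n * (1 + axisSum p (config X ω) n b t) := by
  classical
  have hk0 : (0 : ℝ) < k := by positivity
  filter_upwards [h.ae_eventually_retainedSum hp hk hγ hβ (C := 9 * k) (K := (k : ℝ))
    (by positivity) (by positivity) (fun n => axisWeights k n b)
    (fun n => card_axisWeights_le hk n b)
    (fun n q hq c => by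
      obtain ⟨i, _, rfl⟩ := Finset.mem_image.1 hq
      exact intervalKernel_nonneg _ _)
    (fun n q hq c => by
      obtain ⟨i, _, rfl⟩ := Finset.mem_image.1 hq
      refine (intervalKernel_le _ _).trans ?_
      gcongr
      norm_num)] with ω hω
  filter_upwards [hω] with n hn t
  set x := config X ω
  rcases lt_or_ge 4 |t| with ht | ht
  · have h0 : ∀ m, axisSum p x m b t = 0 := fun m => by
      rw [axisSum, Finset.sum_eq_zero fun c _ => intervalKernel_eq_zero_of_lt hk _ ht, zero_div]
    rw [h0, h0]
    simp only [sub_self, abs_zero]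
    positivity
  set N : ℕ := k ^ (n + 1) with hN
  have hN0 : (0 : ℝ) < N := by rw [hN]; positivity
  -- Rounding down to the grid stays in the same half-open interval, so the kernels do not change
  -- and the net is exact.
  set t' : ℝ := (⌊t * N⌋ : ℝ) / N with ht'
  have hcongr : ∀ c : Address k (n + 1),
      intervalKernel (coordWord b c) t' = intervalKernel (coordWord b c) t := by
    refine fun c => intervalKernel_congr hk _ fun m => ?_
    have hN' : (k : ℝ) ^ (n + 1) = N := by rw [hN]; push_cast; rfl
    rw [hN', ht', div_le_div_iff_of_pos_right hN0, div_le_iff₀ hN0, ← Int.cast_natCast,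
      Int.cast_le, Int.le_floor]
  have hmem : ((1 : ℝ), fun c : Address k (n + 1) => intervalKernel (coordWord b c) t)
      ∈ axisWeights k n b := by
    simp only [← hcongr]
    rw [abs_le] at ht
    refine Finset.mem_image.2 ⟨⌊t * N⌋, Finset.mem_Icc.2 ⟨Int.le_floor.2 ?_, ?_⟩, rfl⟩
    · have hN' : (N : ℝ) = (k : ℝ) ^ (n + 1) := by rw [hN]; push_cast; rfl
      push_cast
      rw [← hN']
      nlinarith
    · have : (⌊t * N⌋ : ℝ) ≤ (4 * N : ℝ) := (Int.floor_le _).trans (by nlinarith)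
      exact_mod_cast this
  have hnet := hn _ hmem
  dsimp only at hnet
  rw [childrenSum_intervalKernel hk] at hnet
  exact hnet

end AxisNet

/-! ### Positivity of the limiting population on survival. -/

section Survival

variable {Ω : Type*} [mΩ : MeasurableSpace Ω] {P : Measure Ω} [IsProbabilityMeasure P]
  {k : ℕ} {p : ℝ} {X : (Σ n : ℕ, Address k n) → Ω → Bool}

/-- A linear fractional minorant of the map `y ↦ 1 - g (1 - y)`, where `g` is the generating
function of a binomial offspring law of mean `q`. -/
noncomputable def growth (q y : ℝ) : ℝ := q * y / (1 + q * y)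

lemma growth_pos {q y : ℝ} (hq : 0 < q) (hy : 0 < y) : 0 < growth q y := by
  unfold growth; positivity

lemma growth_le_one {q y : ℝ} (hq : 0 < q) (hy : 0 < y) : growth q y ≤ 1 := by
  unfold growth
  rw [div_le_one (by positivity)]
  linarith

lemma iterate_growth_mem {q y : ℝ} (hq : 0 < q) (hy : 0 < y) (hy1 : y ≤ 1) (m : ℕ) :
    0 < (growth q)^[m] y ∧ (growth q)^[m] y ≤ 1 := by
  induction m with
  | zero => exact ⟨hy, hy1⟩
  | succ m ih =>
    rw [Function.iterate_succ_apply']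
    exact ⟨growth_pos hq ih.1, growth_le_one hq ih.1⟩

/-- In the coordinate 1/y the map `growth q` is affine, z ↦ z/q + 1, and its iterates add up a
geometric series bounded by 2. -/
lemma inv_iterate_growth_le {q y : ℝ} (hq : 2 ≤ q) (hy : 0 < y) (hy1 : y ≤ 1) (m : ℕ) :
    ((growth q)^[m] y)⁻¹ ≤ (q ^ m * y)⁻¹ + 2 := by
  have hq0 : 0 < q := by linarith
  induction m with
  | zero => simp
  | succ m ih =>
    rw [Function.iterate_succ_apply']
    have hz := (iterate_growth_mem hq0 hy hy1 m).1
    set z := (growth q)^[m] y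
    have h1 : (growth q z)⁻¹ = z⁻¹ / q + 1 := by
      unfold growth; field_simp
    have h2 : (q ^ (m + 1) * y)⁻¹ = (q ^ m * y)⁻¹ / q := by
      rw [pow_succ]; field_simp
    rw [h1, h2]
    have h3 : z⁻¹ / q ≤ ((q ^ m * y)⁻¹ + 2) / q := by gcongr
    have h4 : 2 / q ≤ 1 := (div_le_one hq0).2 hq
    rw [add_div] at h3
    linarith

/-- By Bernoulli, 1 + Npy ≤ (1 + py)^N, and (1 - py)(1 + py) ≤ 1. -/
lemma one_sub_pow_le_one_sub_growth {p y : ℝ} (hp : 0 ≤ p) (hp1 : p ≤ 1) (hy : 0 ≤ y) (hy1 : y ≤ 1)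
    (N : ℕ) : (1 - p * y) ^ N ≤ 1 - growth (N * p) y := by
  have hpy : p * y ≤ 1 := by nlinarith
  have hpy0 : 0 ≤ p * y := by positivity
  have h1 : 1 - growth (N * p) y = 1 / (1 + N * (p * y)) := by
    have : (0 : ℝ) < 1 + N * p * y := by positivity
    unfold growth
    rw [← mul_assoc]
    field_simp
    ring
  rw [h1, le_div_iff₀ (by positivity)]
  calc (1 - p * y) ^ N * (1 + N * (p * y)) ≤ (1 - p * y) ^ N * (1 + p * y) ^ N := by
        have := one_add_mul_le_pow (show -2 ≤ p * y by linarith) N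
        have h0 : 0 ≤ 1 - p * y := by linarith
        gcongr
    _ = ((1 - p * y) * (1 + p * y)) ^ N := by rw [mul_pow]
    _ ≤ 1 := pow_le_one₀ (mul_nonneg (by linarith) (by linarith)) (by nlinarith)

/-- The number of retained squares of level `n`. -/
noncomputable abbrev population (X : (Σ n : ℕ, Address k n) → Ω → Bool) (n : ℕ) (ω : Ω) : ℕ :=
  (retainedSet (config X ω) n).card

/-- One generation of the branching process: given N squares, the mean of (1 - y) to the next
population is (1 - py)^(k²N). The set `T` from the past makes this a conditional statement. -/
lemma IsPercolation.setLIntegral_pow_succ_le (h : IsPercolation P p X) (hp : 0 < p) (hp1 : p ≤ 1)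
    (n : ℕ) {T : Set Ω} (hT : MeasurableSet[levelFiltration h.measurable n] T) {y : ℝ}
    (hy : 0 < y) (hy1 : y ≤ 1) :
    ∫⁻ ω in T, ENNReal.ofReal ((1 - y) ^ population X (n + 1) ω) ∂P
      ≤ ∫⁻ ω in T, ENNReal.ofReal ((1 - growth (k ^ 2 * p) y) ^ population X n ω) ∂P := by
  set Y : Finset (Address k n) → Ω → ℝ≥0∞ := fun S ω =>
    ∏ c ∈ children S, ENNReal.ofReal (if X ⟨n + 1, c⟩ ω = true then 1 - y else 1) with hY
  have hmeas : ∀ c : Address k (n + 1), Measurable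
      (fun b : Bool => ENNReal.ofReal (if b = true then 1 - y else 1)) :=
    fun _ => measurable_from_top
  have hYm : ∀ S, Measurable[nextLevel X n] (Y S) := by
    intro S
    refine Finset.measurable_fun_prod _ fun c _ => ?_
    exact (hmeas c).comp
      (measurable_sigmaOf (X := X) (s := {c | c.1 = n + 1}) (c := ⟨n + 1, c⟩) rfl)
  have hleft : ∀ ω, ENNReal.ofReal ((1 - y) ^ population X (n + 1) ω)
      = Y (retainedSet (config X ω) n) ω := by
    intro ω
    rw [hY, population, retainedSet_succ, ENNReal.ofReal_pow (by linarith),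
      ← Finset.prod_const, Finset.prod_filter]
    refine Finset.prod_congr rfl fun c _ => ?_
    split_ifs <;> simp
  simp only [hleft]
  rw [h.setLIntegral_retainedSet n hT hYm]
  refine lintegral_mono fun ω => ?_
  have hind := (h.iIndepFun_level (n + 1)).comp _ hmeas
  have hone : ∀ c : Address k (n + 1),
      ∫⁻ ω, ENNReal.ofReal (if X ⟨n + 1, c⟩ ω = true then 1 - y else 1) ∂P
        = ENNReal.ofReal (1 - p * y) := by
    intro c
    rw [← ofReal_integral_eq_lintegral_ofReal, h.integral_ite hp.le]
    · congr 1; ring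
    · refine Integrable.of_mem_Icc 0 1 ?_ (ae_of_all _ fun ω => ?_)
      · exact ((measurable_from_top (f := fun b : Bool => if b = true then 1 - y else 1)).comp
          (h.measurable ⟨n + 1, c⟩)).aemeasurable
      · split_ifs
        · exact ⟨by linarith, by linarith⟩
        · simp
    · refine ae_of_all _ fun ω => ?_
      simp only [Pi.zero_apply]
      split_ifs <;> linarith
  have hprod := lintegral_prod_eq_prod_lintegral_of_indepFun
    (children (retainedSet (config X ω) n)) _ hind fun c => (hmeas c).comp (h.measurable _)
  simp only [Function.comp_apply, hone, Finset.prod_const, card_children] at hprod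
  refine hprod.trans_le ?_
  have hpy : p * y ≤ 1 := by nlinarith
  rw [← ENNReal.ofReal_pow (by linarith), pow_mul]
  refine ENNReal.ofReal_le_ofReal (pow_le_pow_left₀ (by
    have : (0 : ℝ) ≤ 1 - p * y := by linarith
    positivity) ?_ _)
  have := one_sub_pow_le_one_sub_growth hp.le hp1 hy.le hy1 (k ^ 2)
  push_cast at this
  exact this

lemma IsPercolation.setLIntegral_pow_add_le (h : IsPercolation P p X) (hp : 0 < p) (hp1 : p ≤ 1)
    (hk : 2 ≤ k) (n : ℕ) {T : Set Ω} (hT : MeasurableSet[levelFiltration h.measurable n] T) (m : ℕ)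
    {y : ℝ} (hy : 0 < y) (hy1 : y ≤ 1) :
    ∫⁻ ω in T, ENNReal.ofReal ((1 - y) ^ population X (n + m) ω) ∂P
      ≤ ∫⁻ ω in T, ENNReal.ofReal ((1 - (growth (k ^ 2 * p))^[m] y) ^ population X n ω) ∂P := by
  have hq : 0 < (k : ℝ) ^ 2 * p := by positivity
  induction m generalizing y with
  | zero => simp
  | succ m ih =>
    rw [← add_assoc, Function.iterate_succ_apply]
    exact (h.setLIntegral_pow_succ_le hp hp1 (n + m)
      ((levelFiltration h.measurable).mono (Nat.le_add_right n m) _ hT) hy hy1).trans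
      (ih (growth_pos hq hy) (growth_le_one hq hy))

/-- The event that the normalised population tends to `0`. -/
def vanishing (p : ℝ) (X : (Σ n : ℕ, Address k n) → Ω → Bool) : Set Ω :=
  {ω | Tendsto (fun n : ℕ => (population X n ω : ℝ) / ((k : ℝ) ^ 2 * p) ^ n) atTop (𝓝 0)}

omit [IsProbabilityMeasure P] in
lemma IsPercolation.measurableSet_vanishing (h : IsPercolation P p X) :
    MeasurableSet[⨆ n, levelFiltration h.measurable n] (vanishing p X) := by
  refine measurableSet_tendsto (𝓝 0) fun n => ?_
  exact (measurable_comp_retainedSet h.measurable n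
    fun S => (S.card : ℝ) / ((k : ℝ) ^ 2 * p) ^ n).mono
      (le_iSup (fun n => levelFiltration h.measurable n) n) le_rfl

/-- Take y = q^(-m) in the generating function of generation n + m. Where the normalised population
vanishes, (1 - y) to this population tends to 1, so Fatou bounds the measure; the m-th iterate of
`growth q` at y is at least 1/3, and the population at level n is at least 1, which gives 2/3. -/
lemma IsPercolation.measure_inter_vanishing_le (h : IsPercolation P p X) (hp : 0 < p) (hp1 : p ≤ 1)
    (hk : 2 ≤ k) (hkp : 1 < k * p) (n : ℕ) {T : Set Ω}
    (hT : MeasurableSet[levelFiltration h.measurable n] T)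
    (hT1 : ∀ ω ∈ T, 1 ≤ population X n ω) :
    P (T ∩ vanishing p X) ≤ ENNReal.ofReal (2 / 3) * P T := by
  have hTm : MeasurableSet T := (levelFiltration h.measurable).le n _ hT
  set q : ℝ := (k : ℝ) ^ 2 * p with hq
  have hk2 : (2 : ℝ) ≤ k := by exact_mod_cast hk
  have hq2 : 2 ≤ q := by rw [hq]; nlinarith
  have hq0 : 0 < q := by linarith
  have hD : MeasurableSet (vanishing p X) :=
    iSup_le (fun n => (levelFiltration h.measurable).le n) _ h.measurableSet_vanishing
  have hbound : ∀ m : ℕ, ∫⁻ ω in T, ENNReal.ofReal ((1 - (q ^ m)⁻¹) ^ population X (n + m) ω) ∂P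
      ≤ ENNReal.ofReal (2 / 3) * P T := by
    intro m
    have hy : 0 < (q ^ m)⁻¹ := by positivity
    have hy1 : (q ^ m)⁻¹ ≤ 1 := inv_le_one_of_one_le₀ (one_le_pow₀ (by linarith))
    refine (h.setLIntegral_pow_add_le hp hp1 hk n hT m hy hy1).trans ?_
    obtain ⟨hz0, hz1⟩ := iterate_growth_mem hq0 hy hy1 m
    have hz := inv_iterate_growth_le hq2 hy hy1 m
    rw [mul_inv_cancel₀ (by positivity), inv_one] at hz
    have hz3 : 1 / 3 ≤ (growth q)^[m] (q ^ m)⁻¹ := by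
      rw [one_div, inv_le_comm₀ (by norm_num) hz0]
      linarith
    rw [← setLIntegral_const]
    refine setLIntegral_mono measurable_const fun ω hω => ENNReal.ofReal_le_ofReal ?_
    refine (pow_le_of_le_one (by linarith) (by linarith) ?_).trans (by linarith)
    have := hT1 ω hω
    omega
  calc P (T ∩ vanishing p X) = ∫⁻ ω in T ∩ vanishing p X, 1 ∂P := by simp
    _ ≤ ∫⁻ ω in T ∩ vanishing p X,
          liminf (fun m : ℕ => ENNReal.ofReal ((1 - (q ^ m)⁻¹) ^ population X (n + m) ω)) atTop ∂P := by
        refine setLIntegral_mono' (hTm.inter hD) fun ω hω => ?_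
        refine le_of_eq (Tendsto.liminf_eq ?_).symm
        rw [← ENNReal.ofReal_one]
        refine (ENNReal.continuous_ofReal.tendsto 1).comp ?_
        have h0 : Tendsto (fun m : ℕ => 1 - q ^ n * ((population X (m + n) ω : ℝ) / q ^ (m + n)))
            atTop (𝓝 1) := by
          have := ((tendsto_add_atTop_iff_nat n).2 hω.2).const_mul (q ^ n) |>.const_sub 1
          simpa using this
        refine tendsto_of_tendsto_of_tendsto_of_le_of_le h0 tendsto_const_nhds (fun m => ?_)
          fun m => ?_
        -- Lower bound by Bernoulli's inequality (1 - y)^N ≥ 1 - Ny.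
        · have hy1 : (q ^ m)⁻¹ ≤ 1 := inv_le_one_of_one_le₀ (one_le_pow₀ (by linarith))
          have := one_add_mul_le_pow (a := -(q ^ m)⁻¹) (by linarith) (population X (n + m) ω)
          dsimp only
          rw [← sub_eq_add_neg] at this
          refine le_trans (le_of_eq ?_) this
          rw [add_comm m n, pow_add]
          field_simp
          ring
        · have hy : 0 < (q ^ m)⁻¹ := by positivity
          have hy1 : (q ^ m)⁻¹ ≤ 1 := inv_le_one_of_one_le₀ (one_le_pow₀ (by linarith))
          exact pow_le_one₀ (by linarith) (by linarith)
    _ ≤ ∫⁻ ω in T,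
          liminf (fun m : ℕ => ENNReal.ofReal ((1 - (q ^ m)⁻¹) ^ population X (n + m) ω)) atTop ∂P :=
        lintegral_mono_set Set.inter_subset_left
    _ ≤ liminf (fun m : ℕ => ∫⁻ ω in T,
          ENNReal.ofReal ((1 - (q ^ m)⁻¹) ^ population X (n + m) ω) ∂P) atTop := by
        refine lintegral_liminf_le fun m => ?_
        exact (measurable_comp_retainedSet h.measurable (n + m)
          fun S => ENNReal.ofReal ((1 - (q ^ m)⁻¹) ^ S.card)).mono
            ((levelFiltration h.measurable).le _) le_rfl
    _ ≤ _ := by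
        refine (liminf_le_liminf (Eventually.of_forall hbound)).trans ?_
        simp

/-- Almost surely, if no generation is empty, then the normalised population does not tend
to `0`. -/
lemma IsPercolation.ae_notMem_vanishing (h : IsPercolation P p X) (hp : 0 < p) (hp1 : p ≤ 1)
    (hk : 2 ≤ k) (hkp : 1 < k * p) :
    ∀ᵐ ω ∂P, (∀ n, 1 ≤ population X n ω) → ω ∉ vanishing p X := by
  set F := levelFiltration h.measurable
  have hFle : ⨆ n, F n ≤ mΩ := iSup_le F.le
  have hD := h.measurableSet_vanishing
  set f : Ω → ℝ := (vanishing p X).indicator 1 with hf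
  have hfm : StronglyMeasurable[⨆ n, F n] f :=
    StronglyMeasurable.indicator stronglyMeasurable_one hD
  have hfi : Integrable f P := (integrable_const (1 : ℝ)).indicator (hFle _ hD)
  have hle : ∀ n, ∀ᵐ ω ∂P, 1 ≤ population X n ω → (P[f | F n]) ω ≤ 2 / 3 := by
    intro n
    -- On this event from the past the conditional probability exceeds 2/3, while its integral is at
    -- most 2/3 of the measure: the event is null.
    set B : Set Ω := {ω | 1 ≤ population X n ω} ∩ {ω | 2 / 3 < (P[f | F n]) ω} with hB
    have hB1 : MeasurableSet[F n] {ω | 1 ≤ population X n ω} :=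
      @measurable_retainedSet _ _ _ _ h.measurable n {S | 1 ≤ S.card} trivial
    have hBm : MeasurableSet[F n] B :=
      hB1.inter (stronglyMeasurable_condExp.measurable measurableSet_Ioi)
    have hBm' : MeasurableSet B := F.le n _ hBm
    have h1 : ∫ ω in B, (P[f | F n]) ω ∂P ≤ 2 / 3 * P.real B := by
      rw [setIntegral_condExp (F.le n) hfi hBm, hf, setIntegral_indicator (hFle _ hD)]
      simp only [Pi.one_apply, setIntegral_const, smul_eq_mul, mul_one]
      have := ENNReal.toReal_mono (by finiteness)
        (h.measure_inter_vanishing_le hp hp1 hk hkp n hBm fun ω hω => hω.1)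
      rwa [ENNReal.toReal_mul, ENNReal.toReal_ofReal (by norm_num)] at this
    have h2 : ∫ ω in B, ((P[f | F n]) ω - 2 / 3) ∂P ≤ 0 := by
      rw [integral_sub integrable_condExp.integrableOn (integrable_const _)]
      simp only [setIntegral_const, smul_eq_mul]
      linarith
    have h3 : P B = 0 := by
      by_contra h0
      refine absurd h2 (not_le.2 ?_)
      rw [setIntegral_pos_iff_support_of_nonneg_ae]
      · refine lt_of_lt_of_le (pos_iff_ne_zero.2 h0) (measure_mono fun ω hω => ⟨?_, hω⟩)
        have := hω.2
        simp only [Set.mem_ofPred_eq] at this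
        simp only [Function.mem_support]
        linarith
      · refine (ae_restrict_iff' hBm').2 (ae_of_all _ fun ω hω => ?_)
        have := hω.2
        simp only [Set.mem_ofPred_eq] at this
        simp only [Pi.zero_apply]
        linarith
      · exact (integrable_condExp.sub (integrable_const _)).integrableOn
    filter_upwards [measure_eq_zero_iff_ae_notMem.1 h3] with ω hω h4
    by_contra h5
    exact hω ⟨h4, not_le.1 h5⟩
  -- Lévy's upward theorem; a limit at most 2/3 is incompatible with the value 1 of the indicator.
  have hlim : ∀ᵐ ω ∂P, Tendsto (fun n => (P[f | F n]) ω) atTop (𝓝 (f ω)) := by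
    have := tendsto_ae_condExp (μ := P) (ℱ := F) f
    rwa [condExp_of_stronglyMeasurable hFle hfm hfi] at this
  filter_upwards [ae_all_iff.2 hle, hlim] with ω h1 h2 h3 h4
  have h5 : f ω ≤ 2 / 3 := le_of_tendsto' h2 fun n => h1 n (h3 n)
  rw [hf, Set.indicator_of_mem h4, Pi.one_apply] at h5
  norm_num at h5

end Survival

/-! ### Characters of the line. -/

section Characters

/-- The character `x ↦ exp (i x)` of the line. -/
noncomputable def expI (x : ℝ) : ℂ := Complex.exp (x * Complex.I)

lemma continuous_expI : Continuous expI := by unfold expI; fun_prop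

lemma norm_expI (x : ℝ) : ‖expI x‖ = 1 := Complex.norm_exp_ofReal_mul_I x

@[simp] lemma expI_zero : expI 0 = 1 := by simp [expI]

lemma norm_expI_sub_le (x y : ℝ) : ‖expI x - expI y‖ ≤ |x - y| := by
  have h : expI x - expI y = expI y * (Complex.exp (Complex.I * ((x - y : ℝ) : ℂ)) - 1) := by
    rw [expI, expI, mul_sub, ← Complex.exp_add, mul_one]
    congr 2
    push_cast
    ring
  rw [h, norm_mul, norm_expI, one_mul]
  exact Real.norm_exp_I_mul_ofReal_sub_one_le

lemma norm_expI_mul_sub_le (s x y r : ℝ) (h : |x - y| ≤ r) :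
    ‖expI (s * x) - expI (s * y)‖ ≤ |s| * r := by
  refine (norm_expI_sub_le _ _).trans ?_
  rw [← mul_sub, abs_mul]
  gcongr

lemma integrable_expI_comp {α : Type*} [MeasurableSpace α] {μ : Measure α} [IsFiniteMeasure μ]
    {f : α → ℝ} (hf : Measurable f) : Integrable (fun z => expI (f z)) μ :=
  Integrable.of_bound (continuous_expI.measurable.comp hf).aestronglyMeasurable 1
    (ae_of_all _ fun _ => (norm_expI _).le)

lemma Integrable.expI_mul {g : ℝ → ℝ} (hg : Integrable g) (s : ℝ) :
    Integrable fun t => expI (s * t) * (g t : ℂ) := by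
  refine hg.ofReal.bdd_mul (c := 1) ?_ (ae_of_all _ fun t => (norm_expI _).le)
  exact (continuous_expI.comp (continuous_const.mul continuous_id)).aestronglyMeasurable

end Characters

/-! ### Lebesgue measure on the retained squares. -/

section Squares

variable {k n : ℕ}

lemma restrict_levelSet (hk : 2 ≤ k) (x : Config k) (n : ℕ) :
    (volume : Measure (ℝ × ℝ)).restrict (levelSet x n)
      = ∑ c ∈ retainedSet x n, (volume : Measure (ℝ × ℝ)).restrict (square c) := by
  ext s hs
  have h := lintegral_biUnion_finset₀ (μ := (volume : Measure (ℝ × ℝ))) (s := retainedSet x n)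
    (t := square) (fun c _ d _ hcd => volume_square_inter hk hcd)
    (fun c _ => (measurableSet_square c).nullMeasurableSet) (s.indicator 1)
  simp only [lintegral_indicator_one hs] at h
  rw [levelSet, h, Measure.finsetSum_apply]

lemma isFiniteMeasure_restrict_square (c : Address k n) :
    IsFiniteMeasure ((volume : Measure (ℝ × ℝ)).restrict (square c)) :=
  ⟨by rw [Measure.restrict_apply_univ, volume_square]; exact ENNReal.ofReal_lt_top⟩

lemma volume_levelSet (hk : 2 ≤ k) (x : Config k) (n : ℕ) :
    volume (levelSet x n) = ENNReal.ofReal ((retainedSet x n).card / ((k : ℝ) ^ 2) ^ n) := by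
  rw [← Measure.restrict_apply_univ, restrict_levelSet hk, Measure.finsetSum_apply]
  simp only [Measure.restrict_apply_univ, volume_square, Finset.sum_const, nsmul_eq_mul]
  rw [← ENNReal.ofReal_natCast, ← ENNReal.ofReal_mul (by positivity), mul_one_div]

lemma norm_setIntegral_square_expI_sub_le {a b : ℝ} (ha : |a| ≤ 1) (hb : |b| ≤ 1)
    (s : ℝ) (c : Address k n) :
    ‖(∫ z in square c, expI (s * (a * z.1 + b * z.2)))
        - (1 / ((k : ℝ) ^ 2) ^ n : ℝ) * expI (s * (a * leftEnd c.1 + b * leftEnd c.2))‖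
      ≤ |s| * (2 / (k : ℝ) ^ n) * (1 / ((k : ℝ) ^ 2) ^ n) := by
  have hfin := isFiniteMeasure_restrict_square c
  have hvol : (volume : Measure (ℝ × ℝ)).real (square c) = 1 / ((k : ℝ) ^ 2) ^ n := by
    rw [measureReal_def, volume_square, ENNReal.toReal_ofReal (by positivity)]
  have hconst : ((1 / ((k : ℝ) ^ 2) ^ n : ℝ) : ℂ) * expI (s * (a * leftEnd c.1 + b * leftEnd c.2))
      = ∫ _ in square c, expI (s * (a * leftEnd c.1 + b * leftEnd c.2)) := by
    rw [setIntegral_const, hvol, Complex.real_smul]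
  rw [hconst, ← integral_sub (integrable_expI_comp (by fun_prop)) (integrable_const _), ← hvol]
  refine norm_setIntegral_le_of_norm_le_const (by rw [volume_square]; exact ENNReal.ofReal_lt_top)
    fun z hz => norm_expI_mul_sub_le _ _ _ _ ?_
  have h1 : |z.1 - leftEnd c.1| ≤ 1 / (k : ℝ) ^ n := by
    have := hz.1
    rw [abs_le]
    constructor <;> linarith [this.1, this.2, show 0 ≤ 1 / (k : ℝ) ^ n by positivity]
  have h2 : |z.2 - leftEnd c.2| ≤ 1 / (k : ℝ) ^ n := by
    have := hz.2
    rw [abs_le]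
    constructor <;> linarith [this.1, this.2, show 0 ≤ 1 / (k : ℝ) ^ n by positivity]
  rw [show a * z.1 + b * z.2 - (a * leftEnd c.1 + b * leftEnd c.2)
    = a * (z.1 - leftEnd c.1) + b * (z.2 - leftEnd c.2) by ring]
  refine (abs_add_le _ _).trans ?_
  rw [abs_mul, abs_mul, show 2 / (k : ℝ) ^ n = 1 / (k : ℝ) ^ n + 1 / (k : ℝ) ^ n by ring]
  exact add_le_add ((mul_le_of_le_one_left (abs_nonneg _) ha).trans h1)
    ((mul_le_of_le_one_left (abs_nonneg _) hb).trans h2)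

end Squares

/-! ### Fourier transforms of projected densities. -/

section ProjKernel

variable {k : ℕ}

/-- The functions `h n c` behave like the densities of the images of the Lebesgue measure on the
squares with addresses `c` under `(x, y) ↦ a * x + b * y`. -/
structure IsProjKernel (a b : ℝ) (h : ∀ n : ℕ, Address k n → ℝ → ℝ) : Prop where
  measurable : ∀ n c, Measurable (h n c)
  integrable : ∀ n c, Integrable (h n c)
  nonneg : ∀ n c t, 0 ≤ h n c t
  integral_eq : ∀ n c, ∫ t, h n c t = 1 / ((k : ℝ) ^ 2) ^ n
  eq_zero : ∀ n c t, 2 / (k : ℝ) ^ n < |t - (a * leftEnd c.1 + b * leftEnd c.2)| → h n c t = 0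

/-- The density of the image of `p⁻ⁿ Leb|_{E_n}` for the kernel `h`. -/
noncomputable def projDensity (p : ℝ) (x : Config k) (h : ∀ n : ℕ, Address k n → ℝ → ℝ)
    (n : ℕ) (t : ℝ) : ℝ :=
  (∑ c ∈ retainedSet x n, h n c t) / p ^ n

variable {a b p : ℝ} {h : ∀ n : ℕ, Address k n → ℝ → ℝ}

lemma IsProjKernel.norm_integral_sub_le (H : IsProjKernel a b h) (s : ℝ) (n : ℕ)
    (c : Address k n) :
    ‖(∫ t, expI (s * t) * (h n c t : ℂ))
        - (1 / ((k : ℝ) ^ 2) ^ n : ℝ) * expI (s * (a * leftEnd c.1 + b * leftEnd c.2))‖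
      ≤ |s| * (2 / (k : ℝ) ^ n) * (1 / ((k : ℝ) ^ 2) ^ n) := by
  set e := expI (s * (a * leftEnd c.1 + b * leftEnd c.2)) with he
  have hconst : ((1 / ((k : ℝ) ^ 2) ^ n : ℝ) : ℂ) * e = ∫ t, e * (h n c t : ℂ) := by
    rw [integral_const_mul, integral_complex_ofReal, H.integral_eq, mul_comm]
  rw [hconst, ← integral_sub (Integrable.expI_mul (H.integrable n c) s)
    (show Integrable fun t => e * (h n c t : ℂ) from (H.integrable n c).ofReal.const_mul e),
    ← H.integral_eq n c, ← integral_const_mul]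
  refine norm_integral_le_of_norm_le ((H.integrable n c).const_mul _) (ae_of_all _ fun t => ?_)
  rw [← sub_mul, norm_mul, Complex.norm_real, Real.norm_of_nonneg (H.nonneg n c t)]
  rcases lt_or_ge (2 / (k : ℝ) ^ n) |t - (a * leftEnd c.1 + b * leftEnd c.2)| with ht | ht
  · rw [H.eq_zero n c t ht, mul_zero, mul_zero]
  · exact mul_le_mul_of_nonneg_right (norm_expI_mul_sub_le _ _ _ _ ht) (H.nonneg n c t)

lemma IsProjKernel.integrable_projDensity (H : IsProjKernel a b h) (x : Config k) (n : ℕ) :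
    Integrable (projDensity p x h n) :=
  (integrable_finsetSum _ fun c _ => H.integrable n c).div_const _

lemma IsProjKernel.measurable_projDensity (H : IsProjKernel a b h) (x : Config k) (n : ℕ) :
    Measurable (projDensity p x h n) :=
  (Finset.measurable_fun_sum _ fun c _ => H.measurable n c).div_const _

lemma IsProjKernel.integral_projDensity (H : IsProjKernel a b h) (x : Config k) (n : ℕ) :
    ∫ t, projDensity p x h n t = (retainedSet x n).card / ((k : ℝ) ^ 2 * p) ^ n := by
  simp only [projDensity]
  rw [integral_div, integral_finsetSum _ fun c _ => H.integrable n c]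
  simp only [H.integral_eq, Finset.sum_const, nsmul_eq_mul]
  rw [mul_one_div, div_div, mul_pow]

lemma IsProjKernel.projDensity_eq_zero (H : IsProjKernel a b h) (hk : 2 ≤ k) (ha : |a| ≤ 1)
    (hb : |b| ≤ 1) (x : Config k) (n : ℕ) {t : ℝ} (ht : 4 < |t|) : projDensity p x h n t = 0 := by
  have hk1 : (1 : ℝ) ≤ (k : ℝ) ^ n := one_le_pow₀ (by exact_mod_cast (by omega : 1 ≤ k))
  rw [projDensity, Finset.sum_eq_zero, zero_div]
  intro c _
  refine H.eq_zero n c t ?_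
  have h1 := abs_mul_leftEnd_add_le hk ha hb c
  have h2 : 2 / (k : ℝ) ^ n ≤ 2 := div_le_self (by norm_num) hk1
  have h3 := abs_sub_abs_le_abs_sub t (a * leftEnd c.1 + b * leftEnd c.2)
  linarith

/-- A character is almost constant on a small square and on the support of its kernel, and both
carry the same mass. Total mass and support thus determine the limit, and it need not be shown that
the kernel is exactly the density of the projected square. -/
lemma IsProjKernel.norm_integral_levelSet_sub_le (H : IsProjKernel a b h) (hk : 2 ≤ k) (hp : 0 < p)
    (ha : |a| ≤ 1) (hb : |b| ≤ 1) (x : Config k) (s : ℝ) (n : ℕ) :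
    ‖((1 / p ^ n : ℝ) : ℂ) * (∫ z in levelSet x n, expI (s * (a * z.1 + b * z.2)))
        - ∫ t, expI (s * t) * (projDensity p x h n t : ℂ)‖
      ≤ 4 * |s| * (1 / k : ℝ) ^ n * ((retainedSet x n).card / ((k : ℝ) ^ 2 * p) ^ n) := by
  have h1 : ∫ z in levelSet x n, expI (s * (a * z.1 + b * z.2))
      = ∑ c ∈ retainedSet x n, ∫ z in square c, expI (s * (a * z.1 + b * z.2)) := by
    rw [restrict_levelSet hk, integral_finsetSum_measure]
    intro c _
    have := isFiniteMeasure_restrict_square c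
    exact integrable_expI_comp (by fun_prop)
  have h2 : ∫ t, expI (s * t) * (projDensity p x h n t : ℂ)
      = ((1 / p ^ n : ℝ) : ℂ) * ∑ c ∈ retainedSet x n, ∫ t, expI (s * t) * (h n c t : ℂ) := by
    rw [← integral_finsetSum _ fun c _ => Integrable.expI_mul (H.integrable n c) s,
      ← integral_const_mul]
    refine integral_congr_ae (ae_of_all _ fun t => ?_)
    simp only [projDensity]
    push_cast
    rw [← Finset.mul_sum]
    ring
  have hpn : (0 : ℝ) < 1 / p ^ n := by positivity
  rw [h1, h2, ← mul_sub, ← Finset.sum_sub_distrib, norm_mul, Complex.norm_real,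
    Real.norm_of_nonneg hpn.le]
  have h3 : ‖∑ c ∈ retainedSet x n, ((∫ z in square c, expI (s * (a * z.1 + b * z.2)))
      - ∫ t, expI (s * t) * (h n c t : ℂ))‖
      ≤ ∑ c ∈ retainedSet x n, 2 * (|s| * (2 / (k : ℝ) ^ n) * (1 / ((k : ℝ) ^ 2) ^ n)) := by
    refine norm_sum_le_of_le _ fun c _ => ?_
    rw [← sub_sub_sub_cancel_right _ _
      ((1 / ((k : ℝ) ^ 2) ^ n : ℝ) * expI (s * (a * leftEnd c.1 + b * leftEnd c.2))), two_mul]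
    exact (norm_sub_le _ _).trans (add_le_add
      (norm_setIntegral_square_expI_sub_le ha hb s c) (H.norm_integral_sub_le s n c))
  rw [Finset.sum_const, nsmul_eq_mul] at h3
  refine (mul_le_mul_of_nonneg_left h3 hpn.le).trans (le_of_eq ?_)
  rw [mul_pow, div_pow, one_pow]
  field_simp
  ring

/-- If the densities of the projections of `p⁻ⁿ Leb|_{E_n}` converge uniformly, then the
characteristic functions of these projections converge to the Fourier transform of the limit. -/
lemma IsProjKernel.tendsto_integral_levelSet (H : IsProjKernel a b h) (hk : 2 ≤ k) (hp : 0 < p)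
    (ha : |a| ≤ 1) (hb : |b| ≤ 1) (x : Config k) {g : ℝ → ℝ} {M γ : ℝ} (hγ : 0 ≤ γ) (hγ1 : γ < 1)
    (hg : ∀ n t, |projDensity p x h n t - g t| ≤ M * γ ^ n) :
    Measurable g ∧ Integrable g ∧
    Tendsto (fun n : ℕ => ((retainedSet x n).card : ℝ) / ((k : ℝ) ^ 2 * p) ^ n) atTop
      (𝓝 (∫ t, g t)) ∧
    ∀ s : ℝ, Tendsto (fun n : ℕ => ((1 / p ^ n : ℝ) : ℂ) *
        (∫ z in levelSet x n, expI (s * (a * z.1 + b * z.2)))) atTop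
      (𝓝 (∫ t, expI (s * t) * (g t : ℂ))) := by
  have hMγ : Tendsto (fun n : ℕ => M * γ ^ n) atTop (𝓝 0) := by
    simpa using (tendsto_pow_atTop_nhds_zero_of_lt_one hγ hγ1).const_mul M
  have hpt : ∀ t, Tendsto (fun n => projDensity p x h n t) atTop (𝓝 (g t)) := fun t => by
    rw [tendsto_iff_dist_tendsto_zero]
    exact squeeze_zero (fun _ => dist_nonneg) (fun n => hg n t) hMγ
  have hgm : Measurable g := measurable_of_tendsto_metrizable
    (fun n => H.measurable_projDensity x n) (tendsto_pi_nhds.2 hpt)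
  have hg0 : ∀ t, 4 < |t| → g t = 0 := fun t ht => by
    have h0 : (fun n => projDensity p x h n t) = fun _ => 0 :=
      funext fun n => H.projDensity_eq_zero hk ha hb x n ht
    exact tendsto_nhds_unique (hpt t) (h0 ▸ tendsto_const_nhds)
  -- All densities live on this interval of length 8, which turns uniform convergence into
  -- convergence of integrals.
  set I : Set ℝ := Set.Icc (-4) 4 with hI
  have hIc : ∀ t, t ∉ I → 4 < |t| := fun t ht => by
    by_contra h
    exact ht (abs_le.1 (not_lt.1 h))
  have hdiff : ∀ n t, |projDensity p x h n t - g t| ≤ I.indicator (fun _ => M * γ ^ n) t := by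
    intro n t
    by_cases ht : t ∈ I
    · rw [Set.indicator_of_mem ht]; exact hg n t
    · rw [Set.indicator_of_notMem ht, hg0 t (hIc t ht),
        H.projDensity_eq_zero hk ha hb x n (hIc t ht), sub_zero, abs_zero]
  have hIint : ∀ n, Integrable (I.indicator fun _ => M * γ ^ n) (volume : Measure ℝ) := fun n =>
    (integrable_indicator_iff measurableSet_Icc).2 continuous_const.integrableOn_Icc
  have hgi : Integrable g := by
    have h1 : Integrable (fun t => projDensity p x h 0 t - g t) :=
      (hIint 0).mono' ((H.measurable_projDensity x 0).sub hgm).aestronglyMeasurable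
        (ae_of_all _ fun t => hdiff 0 t)
    have h2 := (H.integrable_projDensity (p := p) x 0).sub h1
    refine h2.congr (ae_of_all _ fun t => ?_)
    simp
  have hB : ∀ s : ℝ, Tendsto (fun n => ∫ t, expI (s * t) * (projDensity p x h n t : ℂ)) atTop
      (𝓝 (∫ t, expI (s * t) * (g t : ℂ))) := by
    intro s
    rw [tendsto_iff_norm_sub_tendsto_zero]
    have hlim : Tendsto (fun n : ℕ => 8 * (M * γ ^ n)) atTop (𝓝 0) := by
      simpa using hMγ.const_mul 8
    refine squeeze_zero (fun _ => norm_nonneg _) (fun n => ?_) hlim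
    rw [← integral_sub (Integrable.expI_mul (H.integrable_projDensity x n) s)
      (Integrable.expI_mul hgi s)]
    refine (norm_integral_le_of_norm_le (hIint n) (ae_of_all _ fun t => ?_)).trans (le_of_eq ?_)
    · rw [← mul_sub, norm_mul, norm_expI, one_mul, ← Complex.ofReal_sub, Complex.norm_real]
      exact hdiff n t
    · rw [integral_indicator_const _ measurableSet_Icc, measureReal_def, Real.volume_Icc,
        ENNReal.toReal_ofReal (by norm_num), smul_eq_mul]
      norm_num
  have hN : Tendsto (fun n : ℕ => ((retainedSet x n).card : ℝ) / ((k : ℝ) ^ 2 * p) ^ n) atTop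
      (𝓝 (∫ t, g t)) := by
    -- Frequency 0 gives the convergence of the normalised population.
    have h0 := hB 0
    simp only [zero_mul, expI_zero, one_mul, integral_complex_ofReal] at h0
    have h1 := (Complex.continuous_re.tendsto _).comp h0
    simpa only [Function.comp_def, Complex.ofReal_re, H.integral_projDensity] using h1
  refine ⟨hgm, hgi, hN, fun s => ?_⟩
  have hk1 : (1 : ℝ) / k < 1 := by
    rw [div_lt_one (by positivity)]
    exact_mod_cast (by omega : 1 < k)
  have hA : Tendsto (fun n : ℕ => 4 * |s| * (1 / k : ℝ) ^ n *
      ((retainedSet x n).card / ((k : ℝ) ^ 2 * p) ^ n)) atTop (𝓝 0) := by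
    simpa using ((tendsto_pow_atTop_nhds_zero_of_lt_one (by positivity) hk1).const_mul
      (4 * |s|)).mul hN
  have hA' := squeeze_zero_norm (fun n => H.norm_integral_levelSet_sub_le hk hp ha hb x s n) hA
  simpa using hA'.add (hB s)

end ProjKernel

/-! ### Construction of the natural measure. -/

section WeakLimit

/-- The character `z ↦ exp (i (u z.1 + v z.2))` of the plane. -/
noncomputable def planeChar (u v : ℝ) : (ℝ × ℝ) →ᵇ ℂ :=
  BoundedContinuousFunction.ofNormedAddCommGroup (fun z => expI (u * z.1 + v * z.2))
    (continuous_expI.comp (by fun_prop)) 1 fun _ => (norm_expI _).le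

lemma charFun_map_toLp (ν : ProbabilityMeasure (ℝ × ℝ)) (t : WithLp 2 (ℝ × ℝ)) :
    charFun ((ν.map (WithLp.prod_continuous_toLp 2 ℝ ℝ).measurable.aemeasurable :
      ProbabilityMeasure (WithLp 2 (ℝ × ℝ))) : Measure (WithLp 2 (ℝ × ℝ))) t
      = ∫ z, expI ((WithLp.ofLp t).1 * z.1 + (WithLp.ofLp t).2 * z.2) ∂(ν : Measure (ℝ × ℝ)) := by
  rw [charFun_apply, ProbabilityMeasure.toMeasure_map, integral_map
    (WithLp.prod_continuous_toLp 2 ℝ ℝ).measurable.aemeasurable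
    (Continuous.aestronglyMeasurable (by fun_prop))]
  refine integral_congr_ae (ae_of_all _ fun z => ?_)
  simp [expI, mul_comm]

/-- Probability measures on a compact subset of the plane whose characteristic functions converge
pointwise converge weakly. -/
lemma exists_weak_limit_of_tendsto_planeChar {ν : ℕ → ProbabilityMeasure (ℝ × ℝ)} {K : Set (ℝ × ℝ)}
    (hK : IsCompact K) (hν : ∀ n, (ν n : Measure (ℝ × ℝ)) Kᶜ = 0) {Φ : ℝ → ℝ → ℂ}
    (hΦ : ∀ u v, Tendsto (fun n => ∫ z, expI (u * z.1 + v * z.2) ∂(ν n : Measure (ℝ × ℝ))) atTop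
      (𝓝 (Φ u v))) :
    ∃ μ : ProbabilityMeasure (ℝ × ℝ), Tendsto ν atTop (𝓝 μ) ∧
      ∀ u v, ∫ z, expI (u * z.1 + v * z.2) ∂(μ : Measure (ℝ × ℝ)) = Φ u v := by
  have htight : IsTightMeasureSet {((μ : ProbabilityMeasure (ℝ × ℝ)) : Measure (ℝ × ℝ)) |
      μ ∈ Set.range ν} := by
    rw [isTightMeasureSet_iff_exists_isCompact_measure_compl_le]
    rintro ε -
    refine ⟨K, hK, ?_⟩
    rintro _ ⟨_, ⟨n, rfl⟩, rfl⟩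
    rw [hν n]
    exact zero_le
  -- A limit along an ultrafilter only serves to realise `Φ` as a characteristic function; the
  -- continuity theorem then upgrades it to a limit of the whole sequence.
  obtain ⟨μ, -, hμ⟩ := (isCompact_closure_of_isTightMeasureSet htight).ultrafilter_le_nhds
    ((hyperfilter ℕ).map ν) (by
      refine le_principal_iff.2 ?_
      exact Filter.mem_of_superset (Filter.range_mem_map) subset_closure)
  have hμ' : Tendsto ν (hyperfilter ℕ) (𝓝 μ) := hμ
  have hchar : ∀ u v, ∫ z, expI (u * z.1 + v * z.2) ∂(μ : Measure (ℝ × ℝ)) = Φ u v := by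
    intro u v
    have h1 := (ProbabilityMeasure.tendsto_iff_forall_integral_rclike_tendsto ℂ).1 hμ'
      (planeChar u v)
    exact tendsto_nhds_unique h1 ((hΦ u v).mono_left Nat.hyperfilter_le_atTop)
  refine ⟨μ, ?_, hchar⟩
  -- `charFun` needs an inner product, whereas ℝ × ℝ carries the sup norm; hence the passage to
  -- `WithLp 2` and back.
  have hE : Tendsto (fun n => (ν n).map
      (WithLp.prod_continuous_toLp 2 ℝ ℝ).measurable.aemeasurable) atTop
      (𝓝 (μ.map (WithLp.prod_continuous_toLp 2 ℝ ℝ).measurable.aemeasurable)) := by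
    refine ProbabilityMeasure.tendsto_of_tendsto_charFun fun t => ?_
    simp only [charFun_map_toLp]
    rw [hchar]
    exact hΦ _ _
  have hback := ProbabilityMeasure.tendsto_map_of_tendsto_of_continuous _ _ hE
    (WithLp.prod_continuous_ofLp 2 ℝ ℝ)
  have hid : ∀ ρ : ProbabilityMeasure (ℝ × ℝ),
      (ρ.map (WithLp.prod_continuous_toLp 2 ℝ ℝ).measurable.aemeasurable).map
        (WithLp.prod_continuous_ofLp 2 ℝ ℝ).measurable.aemeasurable = ρ := by
    intro ρ
    refine Subtype.ext ?_
    change ((ρ : Measure (ℝ × ℝ)).map _).map _ = _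
    rw [Measure.map_map (WithLp.prod_continuous_ofLp 2 ℝ ℝ).measurable
      (WithLp.prod_continuous_toLp 2 ℝ ℝ).measurable]
    exact Measure.map_id
  simpa only [hid] using hback

variable {k : ℕ} {p : ℝ}

lemma integral_cond_levelSet {E : Type*} [NormedAddCommGroup E] [NormedSpace ℝ E] (hk : 2 ≤ k)
    (x : Config k) (n : ℕ) (f : ℝ × ℝ → E) :
    ∫ z, f z ∂((volume : Measure (ℝ × ℝ))[|levelSet x n])
      = ((retainedSet x n).card / ((k : ℝ) ^ 2) ^ n)⁻¹ • ∫ z in levelSet x n, f z := by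
  rw [ProbabilityTheory.cond, integral_smul_measure, volume_levelSet hk, ENNReal.toReal_inv,
    ENNReal.toReal_ofReal (by positivity)]

/-- If the characteristic functions of the measures `p⁻ⁿ Leb|_{E_n}` converge, then the natural
measure exists. -/
lemma exists_isNaturalMeasure (hk : 2 ≤ k) (hp : 0 < p) (x : Config k)
    (hne : ∀ n, (retainedSet x n).Nonempty) {Z : ℝ} (hZ : 0 < Z)
    (hlim : Tendsto (fun n : ℕ => ((retainedSet x n).card : ℝ) / ((k : ℝ) ^ 2 * p) ^ n) atTop (𝓝 Z))
    {Φ : ℝ → ℝ → ℂ} (hΦ : ∀ u v, Tendsto (fun n : ℕ => ((1 / p ^ n : ℝ) : ℂ) *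
      ∫ z in levelSet x n, expI (u * z.1 + v * z.2)) atTop (𝓝 (Φ u v))) :
    ∃ μ : Measure (ℝ × ℝ), IsNaturalMeasure p x μ ∧
      ∀ u v, ∫ z, expI (u * z.1 + v * z.2) ∂μ = Φ u v / Z := by
  have hk0 : (0 : ℝ) < k := by positivity
  have hcard : ∀ n, (0 : ℝ) < (retainedSet x n).card := fun n => by
    exact_mod_cast (hne n).card_pos
  have hvol0 : ∀ n, volume (levelSet x n) ≠ 0 := fun n => by
    rw [volume_levelSet hk]
    have := hcard n
    simpa using (by positivity : 0 < ((retainedSet x n).card : ℝ) / ((k : ℝ) ^ 2) ^ n)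
  have hvolt : ∀ n, volume (levelSet x n) ≠ ∞ := fun n => by
    rw [volume_levelSet hk]; exact ENNReal.ofReal_ne_top
  -- Normalising by the actual area gives exact probability measures; they differ from
  -- `levelMeasure` by a scalar factor tending to 1.
  set ν : ℕ → ProbabilityMeasure (ℝ × ℝ) := fun n =>
    ⟨(volume : Measure (ℝ × ℝ))[|levelSet x n],
      cond_isProbabilityMeasure_of_finite (hvol0 n) (hvolt n)⟩ with hν
  have hsupp : ∀ n, (ν n : Measure (ℝ × ℝ)) (Set.Icc (0 : ℝ) 1 ×ˢ Set.Icc (0 : ℝ) 1)ᶜ = 0 := by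
    intro n
    change (volume : Measure (ℝ × ℝ))[|levelSet x n] _ = 0
    rw [cond_apply (measurableSet_levelSet x n)]
    have : levelSet x n ∩ (Set.Icc (0 : ℝ) 1 ×ˢ Set.Icc (0 : ℝ) 1)ᶜ = ∅ := by
      rw [← Set.sdiff_eq, Set.sdiff_eq_empty]
      exact levelSet_subset_unit hk x n
    rw [this, measure_empty, mul_zero]
  have hchar : ∀ u v, Tendsto (fun n => ∫ z, expI (u * z.1 + v * z.2) ∂(ν n : Measure (ℝ × ℝ)))
      atTop (𝓝 (Φ u v / Z)) := by
    intro u v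
    have hZc : Tendsto (fun n : ℕ =>
        ((((retainedSet x n).card : ℝ) / ((k : ℝ) ^ 2 * p) ^ n : ℝ) : ℂ)) atTop (𝓝 (Z : ℂ)) :=
      (Complex.continuous_ofReal.tendsto Z).comp hlim
    refine ((hΦ u v).div hZc (by exact_mod_cast hZ.ne')).congr fun n => ?_
    change _ = ∫ z, expI (u * z.1 + v * z.2) ∂((volume : Measure (ℝ × ℝ))[|levelSet x n])
    rw [integral_cond_levelSet hk, Complex.real_smul, Pi.div_apply, mul_pow]
    have h1 : ((retainedSet x n).card : ℂ) ≠ 0 := by exact_mod_cast (hcard n).ne'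
    have h2 : (k : ℂ) ≠ 0 := by exact_mod_cast hk0.ne'
    have h3 : (p : ℂ) ≠ 0 := by exact_mod_cast hp.ne'
    push_cast
    field_simp
  obtain ⟨μ, hμ, hμchar⟩ := exists_weak_limit_of_tendsto_planeChar
    (isCompact_Icc.prod isCompact_Icc) hsupp hchar
  refine ⟨μ, ⟨Z, hZ, hlim, inferInstance, fun f => ?_⟩, hμchar⟩
  have h1 := (ProbabilityMeasure.tendsto_iff_forall_integral_tendsto.1 hμ) f
  have h2 := (hlim.div_const Z).mul h1
  rw [div_self hZ.ne', one_mul] at h2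
  refine h2.congr fun n => ?_
  change _ * ∫ z, f z ∂((volume : Measure (ℝ × ℝ))[|levelSet x n]) = _
  rw [integral_cond_levelSet hk, levelMeasure, integral_smul_measure,
    ENNReal.toReal_ofReal (by positivity), smul_eq_mul, smul_eq_mul, mul_pow]
  have := hcard n
  field_simp

/-- A probability measure on the plane has a projection with density `g` if its characteristic
function on the corresponding line is the Fourier transform of `g`. -/
lemma isDensity_map_of_expI {μ : Measure (ℝ × ℝ)} [IsProbabilityMeasure μ] {θ : ℝ} {g : ℝ → ℝ}
    (hgm : Measurable g) (hgi : Integrable g) (hg0 : ∀ t, 0 ≤ g t)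
    (h : ∀ s : ℝ, ∫ z, expI (s * (Real.cos θ * z.1 + Real.sin θ * z.2)) ∂μ
      = ∫ t, expI (s * t) * (g t : ℂ)) :
    IsDensity (μ.map (proj θ)) fun t => (g t).toNNReal := by
  refine ⟨hgm.real_toNNReal, ?_⟩
  have hpm : Measurable (proj θ) := by unfold proj; fun_prop
  have hfin : IsFiniteMeasure
      ((volume : Measure ℝ).withDensity fun t => (((g t).toNNReal : ℝ≥0) : ℝ≥0∞)) := by
    refine isFiniteMeasure_withDensity (ne_of_lt ?_)
    exact hgi.lintegral_lt_top
  have : IsProbabilityMeasure (μ.map (proj θ)) :=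
    Measure.isProbabilityMeasure_map hpm.aemeasurable
  refine Measure.ext_of_charFun (funext fun s => ?_)
  rw [charFun_apply_real, charFun_apply_real, integral_map hpm.aemeasurable
    (Continuous.aestronglyMeasurable (by fun_prop)),
    integral_withDensity_eq_integral_smul hgm.real_toNNReal]
  have h1 := h s
  refine Eq.trans (integral_congr_ae (ae_of_all _ fun z => ?_))
    (h1.trans (integral_congr_ae (ae_of_all _ fun t => ?_)))
  · simp only [expI, proj]
    push_cast
    ring_nf
  · simp only [expI, NNReal.smul_def, Real.coe_toNNReal _ (hg0 t), Complex.real_smul]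
    push_cast
    ring

end WeakLimit

/-! ### Limit densities in each direction and choice of exponents. -/

section Directions

variable {k : ℕ} {p : ℝ}

/-- The density of the image of the Lebesgue measure on the square with address `c` under
`(x, y) ↦ a * x + b * y`, for `a * b ≠ 0`. -/
noncomputable def lineKernel (a b : ℝ) (n : ℕ) (c : Address k n) (t : ℝ) : ℝ :=
  |addressKernel a b c t| / |a * b|

lemma lineKernel_eq {a b : ℝ} (n : ℕ) (c : Address k n) (t : ℝ) :
    lineKernel a b n c t = addressKernel a b c t / (a * b) := by
  rw [lineKernel, ← abs_div, abs_of_nonneg]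
  have h := mul_addressKernel_nonneg a b c t
  rw [div_eq_mul_inv, ← mul_self_mul_inv (a * b)⁻¹, inv_inv]
  have h2 : addressKernel a b c t * ((a * b)⁻¹ * (a * b)⁻¹ * (a * b))
    = (a * b * addressKernel a b c t) * ((a * b)⁻¹ * (a * b)⁻¹) := by ring
  rw [h2]
  exact mul_nonneg h (mul_self_nonneg _)

lemma isProjKernel_lineKernel (hk : 2 ≤ k) {a b : ℝ} (ha : |a| ≤ 1) (hb : |b| ≤ 1)
    (hab : a * b ≠ 0) : IsProjKernel (k := k) a b (lineKernel a b) where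
  measurable n c := by
    have : lineKernel a b n c = fun t => addressKernel a b c t / (a * b) :=
      funext (lineKernel_eq n c)
    rw [this]
    exact (((continuous_kernel _ _).comp (continuous_id.sub continuous_const)).measurable).div_const _
  integrable n c := by
    have : lineKernel a b n c = fun t => addressKernel a b c t / (a * b) :=
      funext (lineKernel_eq n c)
    rw [this]
    exact ((integrable_kernel _ _).comp_sub_right _).div_const _
  nonneg n c t := by unfold lineKernel; positivity
  integral_eq n c := by
    simp only [lineKernel_eq, addressKernel]
    rw [integral_div, integral_sub_right_eq_self (fun t => kernel (a / (k : ℝ) ^ n) (b / (k : ℝ) ^ n) t),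
      integral_kernel, ← pow_mul, mul_comm 2 n, pow_mul, div_mul_div_comm, ← sq, div_right_comm,
      div_self hab]
  eq_zero n c t ht := by
    rw [lineKernel, addressKernel_eq_zero_of_lt hk ha hb c ht, abs_zero, zero_div]

lemma projDensity_lineKernel (x : Config k) (a b : ℝ) (n : ℕ) (t : ℝ) :
    projDensity p x (lineKernel a b) n t = projSum p x n a b t / |a * b| := by
  simp only [projDensity, lineKernel, projSum]
  rw [← Finset.sum_div, div_right_comm]

/-- The density of the image of the Lebesgue measure on the square with address `c` under a
coordinate projection. -/
noncomputable def axisKernel (r : Bool) (n : ℕ) (c : Address k n) (t : ℝ) : ℝ :=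
  intervalKernel (coordWord r c) t

lemma isProjKernel_axisKernel (r : Bool) :
    IsProjKernel (k := k) (if r then 0 else 1) (if r then 1 else 0) (axisKernel r) where
  measurable n c := by
    change Measurable (intervalKernel (coordWord r c))
    unfold intervalKernel
    exact measurable_const.indicator measurableSet_Ico
  integrable n c := integrable_intervalKernel _
  nonneg n c t := intervalKernel_nonneg _ _
  integral_eq n c := integral_intervalKernel _
  eq_zero n c t ht := by
    have hpos : 0 ≤ 1 / (k : ℝ) ^ n := by positivity
    have h2 : 2 / (k : ℝ) ^ n = 1 / (k : ℝ) ^ n + 1 / (k : ℝ) ^ n := by ring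
    rw [axisKernel, intervalKernel]
    refine Set.indicator_of_notMem (fun h => ?_) _
    have h3 : |t - leftEnd (coordWord r c)| ≤ 1 / (k : ℝ) ^ n :=
      abs_le.2 ⟨by linarith [h.1], by linarith [h.2]⟩
    have h4 : |t - leftEnd (coordWord r c)| ≤ 2 / (k : ℝ) ^ n := by linarith
    cases r <;> simp only [coordWord, Bool.false_eq_true, if_true, if_false, zero_mul, one_mul,
      zero_add, add_zero] at ht h4 <;> linarith

lemma half_le_abs_of_sq_add_sq {a b : ℝ} (h : a ^ 2 + b ^ 2 = 1) : 1 / 2 ≤ |a| ∨ 1 / 2 ≤ |b| := by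
  by_contra! hcon
  have h5 := pow_le_pow_left₀ (abs_nonneg _) hcon.1.le 2
  have h6 := pow_le_pow_left₀ (abs_nonneg _) hcon.2.le 2
  rw [sq_abs] at h5 h6
  linarith

/-- `g` is the limit of the densities of the images of `p⁻ⁿ Leb|_{E_n}` under
`(x, y) ↦ a * x + b * y`, in the sense of characteristic functions. -/
structure IsLimitDensity (p : ℝ) (x : Config k) (a b : ℝ) (g : ℝ → ℝ) : Prop where
  nonneg : ∀ t, 0 ≤ g t
  measurable : Measurable g
  integrable : Integrable g
  tendsto_card : Tendsto (fun n : ℕ => ((retainedSet x n).card : ℝ) / ((k : ℝ) ^ 2 * p) ^ n) atTop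
    (𝓝 (∫ t, g t))
  tendsto_expI : ∀ s : ℝ, Tendsto (fun n : ℕ => ((1 / p ^ n : ℝ) : ℂ) *
      (∫ z in levelSet x n, expI (s * (a * z.1 + b * z.2)))) atTop
    (𝓝 (∫ t, expI (s * t) * (g t : ℂ)))

lemma IsProjKernel.isLimitDensity {a b : ℝ} {h : ∀ n : ℕ, Address k n → ℝ → ℝ}
    (H : IsProjKernel a b h) (hk : 2 ≤ k) (hp : 0 < p) (ha : |a| ≤ 1) (hb : |b| ≤ 1) (x : Config k)
    {g : ℝ → ℝ} {M γ : ℝ} (hγ : 0 ≤ γ) (hγ1 : γ < 1) (hg0 : ∀ t, 0 ≤ g t)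
    (hg : ∀ n t, |projDensity p x h n t - g t| ≤ M * γ ^ n) : IsLimitDensity p x a b g := by
  obtain ⟨h1, h2, h3, h4⟩ := H.tendsto_integral_levelSet hk hp ha hb x hγ hγ1 hg
  exact ⟨hg0, h1, h2, h3, h4⟩

/-- The density of the projection in a direction that is not parallel to the axes. -/
lemma exists_limit_lineKernel (hk : 2 ≤ k) (hp : 0 < p) {x : Config k} {γ α : ℝ} (hγ : 0 < γ)
    (hγ1 : γ < 1) (hγA : γ < (k : ℝ) ^ 2 / p) (hα : 0 ≤ α)
    (hαγ : (γ / ((k : ℝ) ^ 2 / p)) ^ α = γ) {a b : ℝ} (hab1 : a ^ 2 + b ^ 2 = 1) (hab : a * b ≠ 0)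
    (hx : ∀ᶠ n in atTop, ∀ t : ℝ, |projSum p x (n + 1) a b t - projSum p x n a b t|
        ≤ γ ^ n * (|a * b| + projSum p x n a b t + 51 * (k : ℝ) ^ 3)) :
    ∃ (g : ℝ → ℝ) (C : ℝ), IsLimitDensity p x a b g ∧ 0 ≤ C ∧
      ∀ s t, |g s - g t| ≤ C * |s - t| ^ α := by
  have hk0 : (0 : ℝ) < k := by positivity
  have hd : 0 < |a * b| := abs_pos.2 hab
  have ha : |a| ≤ 1 := abs_le_one_iff_mul_self_le_one.2 (by nlinarith)
  have hb : |b| ≤ 1 := abs_le_one_iff_mul_self_le_one.2 (by nlinarith)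
  have H := isProjKernel_lineKernel hk ha hb hab
  set f : ℕ → ℝ → ℝ := fun n t => projDensity p x (lineKernel a b) n t with hf
  have hf0 : ∀ n t, 0 ≤ f n t := fun n t =>
    div_nonneg (Finset.sum_nonneg fun c _ => H.nonneg n c t) (by positivity)
  have hbd : ∀ n, ∃ B, ∀ t, f n t ≤ B := by
    intro n
    refine ⟨(∑ c ∈ retainedSet x n, (4 * |a * b| / (k : ℝ) ^ n) / |a * b|) / p ^ n, fun t => ?_⟩
    refine div_le_div_of_nonneg_right (Finset.sum_le_sum fun c _ => ?_) (by positivity)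
    exact div_le_div_of_nonneg_right
      (abs_addressKernel_le hk (half_le_abs_of_sq_add_sq hab1) c t) hd.le
  -- Only here is the uniform estimate divided by |ab|, so that the constant blows up towards the
  -- axes.
  obtain ⟨g, M, hg0, hgM, hfg⟩ := exists_geometric_limit hf0 hbd hγ hγ1
    (C := 1 + 51 * (k : ℝ) ^ 3 / |a * b|) (by positivity) (by
      filter_upwards [hx] with n hn t
      have h1 := hn t
      simp only [hf, projDensity_lineKernel]
      rw [← sub_div, abs_div, abs_abs, div_le_iff₀ hd]
      refine h1.trans ?_
      have h2 := projSum_nonneg hp x n a b t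
      have h3 : (1 + 51 * (k : ℝ) ^ 3 / |a * b|) * γ ^ n * (1 + projSum p x n a b t / |a * b|)
          * |a * b| = γ ^ n * (|a * b| + projSum p x n a b t + 51 * (k : ℝ) ^ 3)
            + γ ^ n * (51 * (k : ℝ) ^ 3 * projSum p x n a b t / |a * b|) := by
        field_simp
        ring
      rw [h3]
      exact le_add_of_nonneg_right (by positivity))
  have hM : 0 ≤ M := (hg0 0).trans (hgM 0)
  refine ⟨g, (2 * M + 4 / |a * b| + M * γ) / γ,
    H.isLimitDensity hk hp ha hb x hγ.le hγ1 hg0 hfg, by positivity, fun s t => ?_⟩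
  refine holder_of_lipschitz_approx hγ hγA hα hαγ hM (by positivity) hg0 hgM hfg
    (fun n s t => ?_) s t
  simp only [hf, projDensity_lineKernel]
  rw [← sub_div, abs_div, abs_abs, div_le_iff₀ hd]
  refine (abs_projSum_sub_le hk hp x n a b s a b t).trans (le_of_eq ?_)
  simp only [sub_self, abs_zero, mul_zero, add_zero]
  field_simp

/-- The density of the projection to a coordinate axis. -/
lemma exists_limit_axisKernel (hk : 2 ≤ k) (hp : 0 < p) {x : Config k} {γ α : ℝ} (hγ : 0 < γ)
    (hγ1 : γ < 1) (hαγ : γ ≤ (1 / k : ℝ) ^ α) (r : Bool)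
    (hx : ∀ᶠ n in atTop, ∀ t : ℝ, |axisSum p x (n + 1) r t - axisSum p x n r t|
        ≤ γ ^ n * (1 + axisSum p x n r t)) :
    ∃ (g : ℝ → ℝ) (C : ℝ),
      IsLimitDensity p x (if r then 0 else 1) (if r then 1 else 0) g ∧ 0 ≤ C ∧
      ∀ s t, s ∉ kadicPoints k → t ∉ kadicPoints k →
        |g s - g t| ≤ C * symbolicDist k s t ^ α := by
  have hbd : ∀ n, ∃ B, ∀ t, axisSum p x n r t ≤ B := by
    intro n
    refine ⟨(∑ c ∈ retainedSet x n, 1 / (k : ℝ) ^ n) / p ^ n, fun t => ?_⟩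
    exact div_le_div_of_nonneg_right (Finset.sum_le_sum fun c _ => intervalKernel_le _ _)
      (by positivity)
  obtain ⟨g, M, hg0, hgM, hfg⟩ := exists_geometric_limit (fun n t => axisSum_nonneg hp x n r t)
    hbd hγ hγ1 zero_le_one (by
      filter_upwards [hx] with n hn t
      rw [one_mul]
      exact hn t)
  have hM : 0 ≤ M := (hg0 0).trans (hgM 0)
  exact ⟨g, 2 * M / γ + M, (isProjKernel_axisKernel r).isLimitDensity hk hp
    (by cases r <;> simp) (by cases r <;> simp) x hγ.le hγ1 hg0 hfg, by positivity, fun s t hs ht =>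
    symbolic_holder_of_locally_const hk hγ hαγ hM hg0 hgM hfg
      (fun n s t hs ht h => axisSum_eq_of_notMem_kadicPoints hk x n r hs ht h) hs ht⟩

lemma holderWith_toNNReal {g : ℝ → ℝ} (hg : ∀ t, 0 ≤ g t) {C : ℝ} {α : ℝ≥0} (hC : 0 ≤ C)
    (h : ∀ s t, |g s - g t| ≤ C * |s - t| ^ (α : ℝ)) :
    HolderWith C.toNNReal α fun t => (g t).toNNReal := by
  intro s t
  rw [edist_dist, edist_dist, ENNReal.ofReal_rpow_of_nonneg dist_nonneg α.coe_nonneg,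
    ENNReal.ofNNReal_toNNReal, ← ENNReal.ofReal_mul hC]
  refine ENNReal.ofReal_le_ofReal ?_
  rw [NNReal.dist_eq, Real.coe_toNNReal _ (hg s), Real.coe_toNNReal _ (hg t), Real.dist_eq]
  exact h s t

lemma abs_toNNReal_div_sub_le {g : ℝ → ℝ} (hg : ∀ t, 0 ≤ g t) {Z : ℝ} (hZ : 0 < Z) (s t : ℝ) :
    |(((g s / Z).toNNReal : ℝ≥0) : ℝ) - ((g t / Z).toNNReal : ℝ≥0)| = |g s - g t| / Z := by
  rw [Real.coe_toNNReal _ (div_nonneg (hg s) hZ.le), Real.coe_toNNReal _ (div_nonneg (hg t) hZ.le),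
    ← sub_div, abs_div, abs_of_pos hZ]

/-- If the projections in all directions have limit densities, then the natural measure exists and
its projections have the normalised limit densities. -/
lemma exists_isNaturalMeasure_of_isLimitDensity (hk : 2 ≤ k) (hp : 0 < p) {x : Config k}
    (hne : ∀ n, (retainedSet x n).Nonempty) {Z : ℝ} (hZ : 0 < Z)
    (hlim : Tendsto (fun n : ℕ => ((retainedSet x n).card : ℝ) / ((k : ℝ) ^ 2 * p) ^ n) atTop (𝓝 Z))
    (hdir : ∀ a b : ℝ, a ^ 2 + b ^ 2 = 1 → a * b ≠ 0 → ∃ g, IsLimitDensity p x a b g)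
    {g₁ g₂ : ℝ → ℝ} (h₁ : IsLimitDensity p x 1 0 g₁) (h₂ : IsLimitDensity p x 0 1 g₂) :
    ∃ μ : Measure (ℝ × ℝ), IsNaturalMeasure p x μ ∧
      ∀ θ g, IsLimitDensity p x (Real.cos θ) (Real.sin θ) g →
        IsDensity (μ.map (proj θ)) fun t => (g t / Z).toNNReal := by
  have hΦ : ∀ u v : ℝ, ∃ L : ℂ, Tendsto (fun n : ℕ => ((1 / p ^ n : ℝ) : ℂ) *
      ∫ z in levelSet x n, expI (u * z.1 + v * z.2)) atTop (𝓝 L) := by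
    intro u v
    rcases eq_or_ne v 0 with rfl | hv
    · exact ⟨_, by simpa using h₁.tendsto_expI u⟩
    rcases eq_or_ne u 0 with rfl | hu
    · exact ⟨_, by simpa using h₂.tendsto_expI v⟩
    -- Polar coordinates: the frequency (u, v) is `r` times a unit direction off the axes.
    set r := Real.sqrt (u ^ 2 + v ^ 2) with hr
    have hr0 : 0 < r := Real.sqrt_pos.2 (by positivity)
    have hr2 : r ^ 2 = u ^ 2 + v ^ 2 := Real.sq_sqrt (by positivity)
    obtain ⟨g, hg⟩ := hdir (u / r) (v / r)
      (by rw [div_pow, div_pow, ← add_div, hr2, div_self (by positivity)]) (by positivity)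
    have heq : ∀ z : ℝ × ℝ, u * z.1 + v * z.2 = r * (u / r * z.1 + v / r * z.2) := by
      intro z; field_simp
    simp only [heq]
    exact ⟨_, hg.tendsto_expI r⟩
  choose Φ hΦ using hΦ
  obtain ⟨μ, hμ, hchar⟩ := exists_isNaturalMeasure hk hp x hne hZ hlim hΦ
  obtain ⟨-, -, -, hprob, -⟩ := id hμ
  refine ⟨μ, hμ, fun θ g hg => ?_⟩
  refine isDensity_map_of_expI (hg.measurable.div_const Z) (hg.integrable.div_const Z)
    (fun t => div_nonneg (hg.nonneg t) hZ.le) fun s => ?_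
  have heq : ∀ z : ℝ × ℝ, s * (Real.cos θ * z.1 + Real.sin θ * z.2)
      = s * Real.cos θ * z.1 + s * Real.sin θ * z.2 := fun z => by ring
  have h := hg.tendsto_expI s
  simp only [heq] at h ⊢
  -- The limit at a frequency does not depend on the limit density used to find it, so any one for
  -- this direction may be inserted.
  rw [hchar, tendsto_nhds_unique (hΦ _ _) h, ← integral_div]
  refine integral_congr_ae (ae_of_all _ fun t => ?_)
  push_cast
  ring

/-- With γ² the midpoint of 1/(kp) and 1, kpγ² = (kp + 1)/2 > 1 and γ ≥ γ² ≥ 1/k. The exponent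
solves (γ/A)^α = γ for A = k²/p; since γ/A ≤ 1/k, the same α works for the symbolic metric. -/
lemma exists_rate {k : ℕ} (hk : 2 ≤ k) {p : ℝ} (hp : 0 < p) (hp1 : p < 1) (hkp : 1 < k * p) :
    ∃ (γ : ℝ) (α : ℝ≥0), 0 < α ∧ 0 < γ ∧ γ < 1 ∧ 1 / k ≤ γ ∧ 1 < k * p * γ ^ 2 ∧
      γ < (k : ℝ) ^ 2 / p ∧ (γ / ((k : ℝ) ^ 2 / p)) ^ (α : ℝ) = γ ∧ γ ≤ (1 / k : ℝ) ^ (α : ℝ) := by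
  have hk0 : (0 : ℝ) < k := by positivity
  have hk1 : (1 : ℝ) ≤ k := by exact_mod_cast (by omega : 1 ≤ k)
  set v := (1 + 1 / (k * p)) / 2 with hv
  have hinv : 1 / (k * p) < 1 := (div_lt_one (by positivity)).2 hkp
  have hv0 : 0 < v := by positivity
  have hv1 : v < 1 := by rw [hv]; linarith
  set γ := Real.sqrt v with hγ
  have hγ0 : 0 < γ := Real.sqrt_pos.2 hv0
  have hγ2 : γ ^ 2 = v := Real.sq_sqrt hv0.le
  have hγ1 : γ < 1 := by nlinarith
  have hγv : v ≤ γ := by nlinarith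
  have h1k : 1 / (k : ℝ) ≤ 1 / (k * p) := one_div_le_one_div_of_le (by positivity) (by nlinarith)
  set A := (k : ℝ) ^ 2 / p with hA
  have hkA : k ≤ A := by
    rw [hA, le_div_iff₀ hp]
    nlinarith
  have hA0 : 0 < A := by linarith
  have hr0 : 0 < γ / A := by positivity
  have hr1 : γ / A < 1 := by rw [div_lt_one hA0]; linarith
  have hrk : γ / A ≤ 1 / k := div_le_div₀ zero_le_one hγ1.le hk0 hkA
  have hα : 0 < Real.log γ / Real.log (γ / A) :=
    div_pos_of_neg_of_neg (Real.log_neg hγ0 hγ1) (Real.log_neg hr0 hr1)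
  have hpow : (γ / A) ^ (Real.log γ / Real.log (γ / A)) = γ := by
    rw [Real.rpow_def_of_pos hr0, mul_div_cancel₀ _ (Real.log_neg hr0 hr1).ne, Real.exp_log hγ0]
  refine ⟨γ, ⟨_, hα.le⟩, hα, hγ0, hγ1, by linarith, ?_, by linarith, hpow, ?_⟩
  · rw [hγ2, hv]
    have : k * p * ((1 + 1 / (k * p)) / 2) = (k * p + 1) / 2 := by field_simp
    rw [this]
    linarith
  · calc γ = (γ / A) ^ (Real.log γ / Real.log (γ / A)) := hpow.symm
      _ ≤ _ := Real.rpow_le_rpow hr0.le hrk hα.le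

end Directions

end FractalPercolation

/-! ### Assembly of the theorem. -/

open FractalPercolation

theorem theorem2p1 {Ω : Type*} [MeasurableSpace Ω] (P : Measure Ω) [IsProbabilityMeasure P]
    (k : ℕ) (hk : 2 ≤ k) (p : ℝ) (hp0 : 0 < p) (hp1 : p < 1) (hkp : 1 < (k : ℝ) * p)
    (X : (Σ n : ℕ, FractalPercolation.Address k n) → Ω → Bool)
    (hX : ∀ c, Measurable (X c)) (hindep : iIndepFun X P)
    (hlaw : ∀ c, P {ω | X c ω = true} = ENNReal.ofReal p) :
    ∃ α : ℝ≥0, 0 < α ∧ ∀ᵐ ω ∂P, (FractalPercolation.fractal fun c => X c ω).Nonempty →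
      ∃ μ : Measure (ℝ × ℝ),
        FractalPercolation.IsNaturalMeasure p (fun c => X c ω) μ ∧
        (∀ θ ∈ Set.Ico 0 Real.pi, μ.map (FractalPercolation.proj θ) ≪ volume) ∧
        (∀ θ ∈ Set.Ico 0 Real.pi, θ ≠ 0 → θ ≠ Real.pi / 2 →
          ∃ (g : ℝ → ℝ≥0) (C : ℝ≥0),
            FractalPercolation.IsDensity (μ.map (FractalPercolation.proj θ)) g ∧
            HolderWith C α g) ∧
        (∀ θ : ℝ, θ = 0 ∨ θ = Real.pi / 2 →
          ∃ (g : ℝ → ℝ≥0) (C : ℝ≥0),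
            FractalPercolation.IsDensity (μ.map (FractalPercolation.proj θ)) g ∧
            ∀ s t : ℝ, s ∉ FractalPercolation.kadicPoints k →
              t ∉ FractalPercolation.kadicPoints k →
              |(g s : ℝ) - (g t : ℝ)| ≤
                (C : ℝ) * FractalPercolation.symbolicDist k s t ^ (α : ℝ)) := by
  have h : IsPercolation P p X := ⟨hX, hindep, hlaw⟩
  obtain ⟨γ, α, hα, hγ, hγ1, hγk, hβ, hγA, hαA, hαk⟩ := exists_rate hk hp0 hp1 hkp
  refine ⟨α, hα, ?_⟩
  filter_upwards [h.ae_eventually_projSum hk hp0 hkp hγk hγ1 hβ,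
    h.ae_eventually_axisSum hk hp0 hγ hβ false, h.ae_eventually_axisSum hk hp0 hγ hβ true,
    h.ae_notMem_vanishing hp0 hp1.le hk hkp] with ω hline hcol hrow hvan hE
  set x : Config k := config X ω with hx
  -- The only consequence of E ≠ ∅ that is needed.
  have hne : ∀ n, (retainedSet x n).Nonempty := by
    obtain ⟨z, hz⟩ := hE
    intro n
    obtain ⟨c, hc, -⟩ := Set.mem_iUnion₂.1 (Set.mem_iInter.1 hz n)
    exact ⟨c, hc⟩
  have hline' := fun a b hab1 hab =>
    exists_limit_lineKernel (a := a) (b := b) hk hp0 hγ hγ1 hγA α.2 hαA hab1 hab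
      (by filter_upwards [hline] with n hn t using hn a b t hab1)
  obtain ⟨g₁, C₁, h₁, hC₁, hg₁⟩ := exists_limit_axisKernel hk hp0 hγ hγ1 hαk false hcol
  obtain ⟨g₂, C₂, h₂, hC₂, hg₂⟩ := exists_limit_axisKernel hk hp0 hγ hγ1 hαk true hrow
  simp only [Bool.false_eq_true, if_false, if_true] at h₁ h₂
  obtain ⟨Z, hlim⟩ : ∃ Z, Tendsto (fun n : ℕ => ((retainedSet x n).card : ℝ) / ((k : ℝ) ^ 2 * p) ^ n)
    atTop (𝓝 Z) := ⟨_, h₁.tendsto_card⟩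
  -- A zero limit would put the realization in `vanishing`, which is excluded almost surely on
  -- survival.
  have hZ : 0 < Z := by
    refine lt_of_le_of_ne (ge_of_tendsto' hlim fun n => by positivity) fun h0 => ?_
    rw [← h0] at hlim
    exact hvan (fun n => (hne n).card_pos) hlim
  obtain ⟨μ, hμ, hdens⟩ := exists_isNaturalMeasure_of_isLimitDensity hk hp0 hne hZ hlim
    (fun a b hab1 hab => (hline' a b hab1 hab).imp fun g hg => hg.choose_spec.1) h₁ h₂
  have hdir : ∀ θ ∈ Set.Ico 0 Real.pi, θ ≠ 0 → θ ≠ Real.pi / 2 →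
      ∃ (g : ℝ → ℝ≥0) (C : ℝ≥0), IsDensity (μ.map (proj θ)) g ∧ HolderWith C α g := by
    intro θ hθ hθ0 hθ2
    have hsin : Real.sin θ ≠ 0 :=
      (Real.sin_pos_of_pos_of_lt_pi (lt_of_le_of_ne hθ.1 hθ0.symm) hθ.2).ne'
    have hcos : Real.cos θ ≠ 0 := fun hcos => hθ2 <| Real.injOn_cos ⟨hθ.1, hθ.2.le⟩
      ⟨by positivity, by linarith [Real.pi_pos]⟩ (by rw [hcos, Real.cos_pi_div_two])
    obtain ⟨g, C, hg, hC, hgC⟩ := hline' _ _ (Real.cos_sq_add_sin_sq θ) (mul_ne_zero hcos hsin)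
    refine ⟨_, _, hdens θ g hg, holderWith_toNNReal (C := C / Z)
      (fun t => div_nonneg (hg.nonneg t) hZ.le) (by positivity) fun s t => ?_⟩
    rw [← sub_div, abs_div, abs_of_pos hZ, div_mul_eq_mul_div]
    exact div_le_div_of_nonneg_right (hgC s t) hZ.le
  have haxis : ∀ θ : ℝ, θ = 0 ∨ θ = Real.pi / 2 →
      ∃ (g : ℝ → ℝ≥0) (C : ℝ≥0), IsDensity (μ.map (proj θ)) g ∧
        ∀ s t : ℝ, s ∉ kadicPoints k → t ∉ kadicPoints k →
          |(g s : ℝ) - (g t : ℝ)| ≤ (C : ℝ) * symbolicDist k s t ^ (α : ℝ) := by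
    have key : ∀ (θ : ℝ) (g : ℝ → ℝ) (C : ℝ),
        IsLimitDensity p x (Real.cos θ) (Real.sin θ) g → 0 ≤ C →
        (∀ s t, s ∉ kadicPoints k → t ∉ kadicPoints k →
          |g s - g t| ≤ C * symbolicDist k s t ^ (α : ℝ)) →
        ∃ (g : ℝ → ℝ≥0) (C : ℝ≥0), IsDensity (μ.map (proj θ)) g ∧
        ∀ s t : ℝ, s ∉ kadicPoints k → t ∉ kadicPoints k →
          |(g s : ℝ) - (g t : ℝ)| ≤ (C : ℝ) * symbolicDist k s t ^ (α : ℝ) := by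
      intro θ g C hg hC hgC
      refine ⟨_, (C / Z).toNNReal, hdens θ g hg, fun s t hs ht => ?_⟩
      rw [abs_toNNReal_div_sub_le hg.nonneg hZ, Real.coe_toNNReal _ (by positivity),
        div_mul_eq_mul_div]
      exact div_le_div_of_nonneg_right (hgC s t hs ht) hZ.le
    rintro θ (rfl | rfl)
    · exact key 0 g₁ C₁ (by simpa using h₁) hC₁ hg₁
    · exact key _ g₂ C₂ (by simpa using h₂) hC₂ hg₂
  refine ⟨μ, hμ, fun θ hθ => ?_, hdir, haxis⟩
  obtain ⟨g, -, hg, -⟩ | ⟨g, -, hg, -⟩ : (∃ (g : ℝ → ℝ≥0) (C : ℝ≥0),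
      IsDensity (μ.map (proj θ)) g ∧ HolderWith C α g) ∨ _ := by
    by_cases h0 : θ = 0 ∨ θ = Real.pi / 2
    · exact Or.inr (haxis θ h0)
    · rw [not_or] at h0
      exact Or.inl (hdir θ hθ h0.1 h0.2)
  all_goals
    rw [hg.2]
    exact withDensity_absolutelyContinuous _ _
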